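/- Let $Q$ be a finite toupie quiver: a finite quiver without oriented cycles having a unique source $0$ and a unique sink $\omega$, such that every other vertex is the source of exactly one arrow and the target of exactly one arrow. Let $I\subset\mathbb{C}Q$ be an admissible two-sided ideal ($J^N\subseteq I\subseteq J^2$ for some $N$, where $J$ is the ideal generated by the arrows) and let $A=\mathbb{C}Q/I$. Let $Z$ be the set of arrows from $0$ to $\omega$, and assume $a:=|Z|\ge 1$. Let $\mathrm{HH}^1(A)$ be the first Hochschild cohomology of $A$ (derivations of $A$ modulo inner derivations), a Lie algebra under the Gerstenhaber (commutator) bracket. Paths from $0$ to $\omega$ are called branches. Fix a linear order on the branches. A branch is said to contain a monomial relation if it lies in $I$. Let $W$ be the set of branches of length at least $2$ that do not lie in $I$, and consider the subspace of all $(c_\beta)_{\beta\in W}\in\mathbb{C}^W$ with $\sum_\beta c_\beta\beta\in I$. Let $\rho_1,\dots,\rho_s$ be its basis in reduced row echelon form with respect to the fixed order (each $\rho_i$ has leading coefficient $1$, at its pivot branch, and vanishes at the other pivot branches). Let $B\subseteq W$ be the set of branches that are not pivots. Let $Q_\rho$ be the graph with vertex set $W$ in which two distinct branches are adjacent if some $\rho_i$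 has non-zero coefficients at both, and let $Q_\rho^1,\dots,Q_\rho^r$ be its connected components. For an arrow $\alpha$ and an element $h$ parallel to it, $\alpha\|h$ is the assignment on arrows sending $\alpha$ to $h$ and every other arrow to $0$; a linear combination of such assignments represents a class in $\mathrm{HH}^1(A)$ if it extends to a derivation of $A$ vanishing on all vertex idempotents, and the class is then that of this derivation. Writing $\beta_0$ for the first arrow of a branch $\beta$, the following classes exist in $\mathrm{HH}^1(A)$: - $y_\beta=[\beta_0\|\beta_0]$ for each branch $\beta\in I$; - $t_k=\bigl[\sum_{\beta\in Q_\rho^k}\beta_0\|\beta_0\bigr]$ for $1\le k\le r$; - $z_{u,\beta}=[u\|\beta]$ for $u\in Z$ and $\beta\in B$. Put $L=\langle t_k,\,z_{u,\beta}\rangle$ and $\langle C''_1\rangle=\langle y_\beta\rangle$ (linear spans). Then $L$ and $\langle C''_1\rangle$ are Lie ideals of $\mathrm{HH}^1(A)$, the solvable radical of $\mathrm{HH}^1(A)$ is their direct sum, $$\operatorname{rad}(\mathrm{HH}^1(A))=L\oplus\langle C''_1\rangle,\qquad L\cap\langle C''_1\rangle=0,$$ and the quotient $\mathrm{HH}^1(A)/\operatorname{rad}(\mathrm{HH}^1(A))$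 is isomorphic, as a Lie algebra, to $\mathfrak{sl}_a(\mathbb{C})$. -/

import Mathlib

attribute [local instance 100] LieRing.ofAssociativeRing

/-- All paths of a quiver, with their end points. -/
abbrev QPath (V : Type*) [Quiver V] := Σ a b : V, Quiver.Path a b

/-- All arrows of a quiver, with their end points. -/
abbrev QArrow (V : Type*) [Quiver V] := Σ a b : V, (a ⟶ b)

/-! ### The path algebra -/

/-- The path algebra `k V` of a quiver: the vector space with basis all paths (trivial ones
included), with multiplication given by concatenation of paths, read from left to right. -/
def PathAlgebra (k V : Type*) [Field k] [Quiver V] := QPath V →₀ k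

namespace PathAlgebra

section Construction

variable {k V : Type*} [Field k] [Quiver V]

noncomputable instance : AddCommGroup (PathAlgebra k V) :=
  inferInstanceAs (AddCommGroup (QPath V →₀ k))

noncomputable instance : Module k (PathAlgebra k V) :=
  inferInstanceAs (Module k (QPath V →₀ k))

/-- The basis vector of the path algebra given by a path. -/
noncomputable def ofPath {a b : V} (p : Quiver.Path a b) : PathAlgebra k V :=
  Finsupp.single (⟨a, b, p⟩ : QPath V) (1 : k)

/-- The product of two basis vectors: the concatenated path if the end of the first is the start of
the second, and zero otherwise. -/
noncomputable def pathMul [DecidableEq V] (p q : QPath V) : PathAlgebra k V :=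
  if h : q.1 = p.2.1 then ofPath (p.2.2.comp (q.2.2.cast h rfl)) else 0

/-- The multiplication, as the bilinear extension of the product of paths. -/
noncomputable def mulHom [DecidableEq V] :
    PathAlgebra k V →ₗ[k] PathAlgebra k V →ₗ[k] PathAlgebra k V :=
  Finsupp.linearCombination k
    (fun p : QPath V => (Finsupp.linearCombination k (fun q : QPath V => pathMul p q) :
      PathAlgebra k V →ₗ[k] PathAlgebra k V))

noncomputable instance [DecidableEq V] : Mul (PathAlgebra k V) := ⟨fun x y => mulHom x y⟩

noncomputable instance [Fintype V] : One (PathAlgebra k V) :=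
  ⟨∑ v : V, ofPath (Quiver.Path.nil : Quiver.Path v v)⟩

theorem mul_def' [DecidableEq V] (x y : PathAlgebra k V) : x * y = mulHom x y := rfl

theorem one_def' [Fintype V] :
    (1 : PathAlgebra k V) = ∑ v : V, ofPath (Quiver.Path.nil : Quiver.Path v v) := rfl

theorem hom_ext {M : Type*} [AddCommMonoid M] [Module k M] {f g : PathAlgebra k V →ₗ[k] M}
    (h : ∀ (a b : V) (p : Quiver.Path a b), f (ofPath p) = g (ofPath p)) : f = g := by
  apply Finsupp.lhom_ext'
  rintro ⟨a, b, p⟩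
  ext
  exact h a b p

theorem ofPath_mul_ofPath [DecidableEq V] {a b c : V} (p : Quiver.Path a b)
    (q : Quiver.Path b c) :
    (ofPath p * ofPath q : PathAlgebra k V) = ofPath (p.comp q) := by
  rw [mul_def', mulHom, ofPath, ofPath]
  erw [Finsupp.linearCombination_single, one_smul, Finsupp.linearCombination_single, one_smul]
  simp [pathMul]

theorem ofPath_mul_ofPath_of_ne [DecidableEq V] {a b b' c : V} (h : b' ≠ b)
    (p : Quiver.Path a b) (q : Quiver.Path b' c) :
    (ofPath p * ofPath q : PathAlgebra k V) = 0 := by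
  rw [mul_def', mulHom, ofPath, ofPath]
  erw [Finsupp.linearCombination_single, one_smul, Finsupp.linearCombination_single, one_smul]
  simp [pathMul, h]

theorem mul_assoc' [DecidableEq V] (x y z : PathAlgebra k V) : x * y * z = x * (y * z) := by
  have key : (mulHom (k := k) (V := V)).compr₂ (mulHom (k := k) (V := V)) =
      (LinearMap.lcomp k (PathAlgebra k V →ₗ[k] PathAlgebra k V) (mulHom (k := k) (V := V))) ∘ₗ
        (LinearMap.llcomp k (PathAlgebra k V) (PathAlgebra k V) (PathAlgebra k V)) ∘ₗ
          (mulHom (k := k) (V := V)) := by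
    apply hom_ext; intro a b p
    apply hom_ext; intro b' c q
    apply hom_ext; intro c' d r
    change ofPath p * ofPath q * ofPath r = ofPath p * (ofPath q * ofPath r)
    by_cases h1 : b' = b
    · subst h1
      by_cases h2 : c' = c
      · subst h2
        simp [ofPath_mul_ofPath]
      · simp only [ofPath_mul_ofPath, ofPath_mul_ofPath_of_ne h2]
        exact (map_zero (mulHom (ofPath p))).symm
    · rw [ofPath_mul_ofPath_of_ne h1]
      by_cases h2 : c' = c
      · subst h2
        rw [ofPath_mul_ofPath, ofPath_mul_ofPath_of_ne h1]
        exact LinearMap.congr_fun (map_zero (mulHom (k := k) (V := V))) (ofPath r)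
      · rw [ofPath_mul_ofPath_of_ne h2]
        exact (LinearMap.congr_fun (map_zero (mulHom (k := k) (V := V))) (ofPath r)).trans
          (map_zero (mulHom (ofPath p))).symm
  exact LinearMap.congr_fun (LinearMap.congr_fun (LinearMap.congr_fun key x) y) z

theorem one_mul' [Fintype V] [DecidableEq V] (x : PathAlgebra k V) : 1 * x = x := by
  have key : mulHom (1 : PathAlgebra k V) = LinearMap.id := by
    apply hom_ext; intro a b p
    rw [one_def', map_sum, LinearMap.sum_apply, Finset.sum_eq_single a]
    · exact (ofPath_mul_ofPath _ p).trans (by simp)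
    · intro v _ hv
      exact ofPath_mul_ofPath_of_ne hv.symm _ p
    · simp
  exact LinearMap.congr_fun key x

theorem mul_one' [Fintype V] [DecidableEq V] (x : PathAlgebra k V) : x * 1 = x := by
  have key : (mulHom (k := k) (V := V)).flip 1 = LinearMap.id := by
    apply hom_ext; intro a b p
    rw [LinearMap.flip_apply, one_def', map_sum, Finset.sum_eq_single b]
    · exact (ofPath_mul_ofPath p _).trans (by simp)
    · intro v _ hv
      exact ofPath_mul_ofPath_of_ne hv p _
    · simp
  exact LinearMap.congr_fun key x

noncomputable instance [Fintype V] [DecidableEq V] : Ring (PathAlgebra k V) :=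
  { (inferInstance : AddCommGroup (PathAlgebra k V)),
    (inferInstance : Mul (PathAlgebra k V)),
    (inferInstance : One (PathAlgebra k V)) with
    left_distrib := fun x y z => map_add (mulHom x) y z
    right_distrib := fun x y z => LinearMap.congr_fun (map_add mulHom x y) z
    zero_mul := fun x => LinearMap.congr_fun (map_zero (mulHom (k := k) (V := V))) x
    mul_zero := fun x => map_zero (mulHom x)
    mul_assoc := mul_assoc'
    one_mul := one_mul'
    mul_one := mul_one' }

noncomputable instance [Fintype V] [DecidableEq V] : Algebra k (PathAlgebra k V) :=
  Algebra.ofModule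
    (fun r x y => LinearMap.congr_fun (map_smul (mulHom (k := k) (V := V)) r x) y)
    (fun r x y => map_smul (mulHom x) r y)

end Construction

end PathAlgebra

/-! ### The first Hochschild cohomology of an algebra -/

/-- The Hochschild 1-cocycles of `A` with coefficients in `A`, that is, the `k`-linear derivations
of `A`; a Lie algebra under the Gerstenhaber bracket `[f, g] = f ∘ g - g ∘ f`. -/
def hochschildCocycle₁ (k A : Type*) [Field k] [Ring A] [Algebra k A] :
    LieSubalgebra k (Module.End k A) where
  carrier := {f | ∀ x y : A, f (x * y) = x * f y + f x * y}
  add_mem' := by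
    intro f g hf hg x y
    simp only [LinearMap.add_apply, hf x y, hg x y]
    noncomm_ring
  zero_mem' := by
    intro x y
    simp
  smul_mem' := by
    intro c f hf x y
    simp [hf x y]
  lie_mem' := by
    intro f g hf hg x y
    have hf' : ∀ x y : A, f (x * y) = x * f y + f x * y := hf
    have hg' : ∀ x y : A, g (x * y) = x * g y + g x * y := hg
    simp only [LieRing.of_associative_ring_bracket, LinearMap.sub_apply, Module.End.mul_apply,
      map_add, hf', hg']
    noncomm_ring

/-- The Hochschild 1-coboundaries, that is, the inner derivations `x ↦ a x - x a`. -/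
def hochschildCoboundary₁ (k A : Type*) [Field k] [Ring A] [Algebra k A] :
    LieIdeal k (hochschildCocycle₁ k A) where
  carrier := {f | ∃ a : A, ∀ x : A, (f : Module.End k A) x = a * x - x * a}
  add_mem' := by
    rintro f g ⟨a, ha⟩ ⟨b, hb⟩
    refine ⟨a + b, fun x => ?_⟩
    have h : ((f + g : hochschildCocycle₁ k A) : Module.End k A) x =
        (f : Module.End k A) x + (g : Module.End k A) x := rfl
    rw [h, ha x, hb x]
    noncomm_ring
  zero_mem' := ⟨0, fun x => by simp⟩
  smul_mem' := by
    rintro c f ⟨a, ha⟩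
    refine ⟨c • a, fun x => ?_⟩
    simp [ha x, smul_sub]
  lie_mem := by
    rintro d f ⟨a, ha⟩
    refine ⟨(d : Module.End k A) a, fun x => ?_⟩
    have hd := d.2
    simp only [LieSubalgebra.coe_bracket, LieRing.of_associative_ring_bracket,
      LinearMap.sub_apply, Module.End.mul_apply, ha, map_sub]
    rw [hd a x, hd x a]
    abel

/-- The Lie algebra `HH¹(A)`: cocycles modulo coboundaries, with the Gerstenhaber bracket. -/
abbrev HH₁ (k A : Type*) [Field k] [Ring A] [Algebra k A] :=
  hochschildCocycle₁ k A ⧸ hochschildCoboundary₁ k A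

/-! ### Toupie quivers and toupie algebras -/

/-- `V` is a toupie quiver with source `o` and sink `w`: `o` is the only source, `w` is the only
sink, every other vertex is the start of exactly one arrow and the end of exactly one arrow, and
there are no oriented cycles (equivalently here, the quiver is connected). -/
structure IsToupie {V : Type*} [Quiver V] (o w : V) : Prop where
  source_iff : ∀ v : V, (∀ u : V, IsEmpty (u ⟶ v)) ↔ v = o
  sink_iff : ∀ v : V, (∀ u : V, IsEmpty (v ⟶ u)) ↔ v = w
  out_unique : ∀ v : V, v ≠ o → v ≠ w → Nonempty (Unique (Σ u : V, (v ⟶ u)))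
  in_unique : ∀ v : V, v ≠ o → v ≠ w → Nonempty (Unique (Σ u : V, (u ⟶ v)))
  acyclic : ∀ (v : V) (p : Quiver.Path v v), p.length = 0

section Toupie

variable {k V : Type*} [Field k] [Quiver V] [Fintype V] [DecidableEq V]

/-- An ideal `I` of the path algebra is admissible if `Jᴺ ⊆ I ⊆ J²` for some `N`, where `J` is the
ideal generated by the arrows; `Jⁿ` is the span of the paths of length at least `n`. -/
def IsAdmissible (I : Ideal (PathAlgebra k V)) : Prop :=
  (∃ N : ℕ, ∀ (a b : V) (p : Quiver.Path a b), N ≤ p.length → PathAlgebra.ofPath p ∈ I) ∧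
  (∀ x ∈ I, x ∈ Submodule.span k
    {y : PathAlgebra k V | ∃ (a b : V) (p : Quiver.Path a b),
      2 ≤ p.length ∧ y = PathAlgebra.ofPath p})

variable (I : Ideal (PathAlgebra k V)) (o w : V)

/-- The branches (paths from `o` to `w`) that contain monomial relations, that is, the branches
that vanish in `k V / I`. -/
abbrev MonomialBranch := {p : Quiver.Path o w // PathAlgebra.ofPath p ∈ I}

/-- The branches that are not arrows and do not contain monomial relations. -/
abbrev LongBranch := {p : Quiver.Path o w // 2 ≤ p.length ∧ PathAlgebra.ofPath p ∉ I}

/-- The space of (coefficient vectors of) linear relations in `k V / I` between the branches that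
are not arrows and do not contain monomial relations. -/
noncomputable def branchRelations : Submodule k (LongBranch I o w →₀ k) where
  carrier := {c | (c.sum fun p r => r • PathAlgebra.ofPath p.1) ∈ I}
  add_mem' := by
    intro c d hc hd
    simp only [Set.mem_ofPred_eq] at *
    rw [Finsupp.sum_add_index' (by simp) (by intros; rw [add_smul])]
    exact I.add_mem hc hd
  zero_mem' := by simp
  smul_mem' := by
    intro r c hc
    simp only [Set.mem_ofPred_eq] at *
    rw [Finsupp.sum_smul_index (by simp)]
    simp only [mul_smul]
    rw [← Finsupp.smul_sum]
    exact Submodule.smul_of_tower_mem I r hc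

end Toupie

section Echelon

variable {k ι : Type*} [Field k] [LinearOrder ι]

/-- `i` is a pivot of the subspace `R`: the position of the leading coefficient of some vector. -/
def IsPivot (R : Submodule k (ι →₀ k)) (i : ι) : Prop :=
  ∃ v ∈ R, v i ≠ 0 ∧ ∀ j < i, v j = 0

/-- `v` is a row of the reduced row echelon form of (any matrix whose rows span) `R`: its leading
coefficient is `1`, and it vanishes at all other pivots. -/
def IsReducedRow (R : Submodule k (ι →₀ k)) (v : ι →₀ k) : Prop :=
  v ∈ R ∧ ∃ i, v i = 1 ∧ (∀ j < i, v j = 0) ∧ ∀ j, j ≠ i → IsPivot R j → v j = 0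

end Echelon

section Classes

variable {k V : Type*} [Field k] [Quiver V] [Fintype V] [DecidableEq V]
  (I : Ideal (PathAlgebra k V)) (o w : V) [LinearOrder (Quiver.Path o w)]

/-- The graph `Q_ρ`: its vertices are the branches that are not arrows and do not contain monomial
relations; two of them are joined if some non monomial relation `ρ_i` (a row of the reduced row
echelon form) involves both. -/
def branchGraph : SimpleGraph (LongBranch I o w) where
  Adj p q := p ≠ q ∧ ∃ ρ, IsReducedRow (branchRelations I o w) ρ ∧ ρ p ≠ 0 ∧ ρ q ≠ 0
  symm := ⟨fun _ _ h => ⟨h.1.symm, by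
    obtain ⟨_, ρ, h1, h2, h3⟩ := h
    exact ⟨ρ, h1, h3, h2⟩⟩⟩
  loopless := ⟨fun _ h => h.1 rfl⟩

/-- The irreducible branches that are not arrows: those that are not the leading branch of a
non monomial relation `ρ_i`. -/
abbrev IrreducibleLongBranch := {p : LongBranch I o w // ¬ IsPivot (branchRelations I o w) p}

/-- The image in `k V / I` of a path. -/
noncomputable def pathClass [I.IsTwoSided] {a b : V} (p : Quiver.Path a b) : PathAlgebra k V ⧸ I :=
  Ideal.Quotient.mk I (PathAlgebra.ofPath p)

/-- `x ∈ HH¹(k V / I)` is the class of the cochain `φ` on arrows (an element of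
`Hom_{Eᵉ}(k Q₁, A)`): `x` is represented by the derivation that vanishes on the vertex idempotents
and has value `φ e` on each arrow `e`. -/
def IsClassOf [I.IsTwoSided] (φ : QArrow V → PathAlgebra k V ⧸ I)
    (x : HH₁ k (PathAlgebra k V ⧸ I)) : Prop :=
  ∃ δ : hochschildCocycle₁ k (PathAlgebra k V ⧸ I),
    (∀ v : V, (δ : Module.End k (PathAlgebra k V ⧸ I))
      (pathClass I (Quiver.Path.nil : Quiver.Path v v)) = 0) ∧
    (∀ e : QArrow V, (δ : Module.End k (PathAlgebra k V ⧸ I))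
      (pathClass I e.2.2.toPath) = φ e) ∧
    LieSubmodule.Quotient.mk δ = x

variable {o w}

/-- `e` is the first arrow of the path `p`. -/
def IsFirstArrow {V : Type*} [Quiver V] {o w : V} (e : QArrow V) (p : Quiver.Path o w) : Prop :=
  ∃ (u : V) (f : o ⟶ u) (q : Quiver.Path u w), e = ⟨o, u, f⟩ ∧ p = f.toPath.comp q

open scoped Classical in
/-- The cochain `α₀ ∥ α₀`, where `α₀` is the first arrow of the branch `p`. -/
noncomputable def yCochain [I.IsTwoSided] (p : Quiver.Path o w) (e : QArrow V) :
    PathAlgebra k V ⧸ I :=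
  if IsFirstArrow e p then pathClass I e.2.2.toPath else 0

/-- The cochain `∑ α₀ ∥ α₀`, the sum being over the branches in a connected component of `Q_ρ`. -/
noncomputable def tCochain [I.IsTwoSided] (c : (branchGraph I o w).ConnectedComponent)
    (e : QArrow V) : PathAlgebra k V ⧸ I :=
  ∑ᶠ p : c.supp, yCochain I p.1.1 e

open scoped Classical in
/-- The cochain `u ∥ p`, for an arrow `u` from `o` to `w` and a branch `p`. -/
noncomputable def zCochain [I.IsTwoSided] (u : o ⟶ w) (p : Quiver.Path o w) (e : QArrow V) :
    PathAlgebra k V ⧸ I :=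
  if e = ⟨o, w, u⟩ then pathClass I p else 0

end Classes

section HochschildCohomology

open Quiver

/-! Modulo inner derivations, a derivation of `A` vanishes on the vertex idempotents and hence
preserves every corner `e_a A e_b`. In a toupie quiver parallel paths coincide unless they run from
`o` to `w`. So a normalised derivation multiplies each arrow outside `Z` by a scalar, while an arrow
of `Z` may go anywhere in `e_o A e_w`. A branch of length at least two contains no arrow of `Z`. It
is therefore an eigenvector, its eigenvalue being the sum of the scalars along it, and the only
constraint is that the linear relations between such branches be stable under this diagonal action.
In reduced echelon form this means that the eigenvalues are constant on the components of `Q_ρ`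
(`isDiagStable_of_rows`, `IsDiagStable.eq_of_row`).

Modulo long branches, a normalised derivation acts on `e_o A e_w` through its matrix on `Z`. Every
matrix occurs, and inner derivations give scalar matrices, so traceless parts define a surjective
Lie homomorphism `toSL` from `HH¹(A)` to `sl_a`. As `sl_a` has zero radical, the radical lies in the
kernel. Conversely, a derivation with scalar matrix can be corrected by an inner one, built from a
potential on the vertices, until it kills all arrows not leaving `o` and has zero matrix on `Z`
(`exists_decomposition`). What remains are weights on first arrows of branches and maps from `Z` to
long branches, that is, combinations of `y`, `t` and `z`.

The `y` are central (`lie_monomialCocycles`). Brackets with a derivation of zero matrix fall into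
the abelian span of the `z` (`lie_mem_arrowCocycles`, `lie_arrowCocycles`). Both spans are thus
solvable ideals, and the radical, the kernel of `toSL` and `L ⊔ C` coincide. The sum is direct
because an inner derivation has the same total weight on all parallel paths, and an arrow of `Z`
forces this weight to be zero on branches (`eq_zero_of_monomialCocycles`). -/

/-- Every path between distinct vertices has a first arrow. -/
theorem Quiver.Path.exists_first {V : Type*} [Quiver V] {o w : V} (hne : o ≠ w) (p : Path o w) :
    ∃ (u : V) (f : o ⟶ u) (q : Path u w), p = f.toPath.comp q := by
  have hp : p.length ≠ 0 := fun hp => hne (Path.eq_of_length_zero p hp)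
  obtain ⟨m, hm⟩ := Nat.exists_eq_succ_of_ne_zero hp
  obtain ⟨u, f, q, -, rfl⟩ := Path.eq_toPath_comp_of_length_eq_succ p hm
  exact ⟨u, f, q, rfl⟩

/-- A path between distinct vertices is an arrow or has length at least two. -/
theorem Quiver.Path.eq_toPath_or_two_le_length {V : Type*} [Quiver V] {o w : V}
    (hne : o ≠ w) (p : Path o w) :
    (∃ u : o ⟶ w, p = u.toPath) ∨ 2 ≤ p.length := by
  cases p with
  | nil => exact absurd rfl hne
  | cons p e =>
    cases p with
    | nil => exact Or.inl ⟨e, rfl⟩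
    | cons p e => exact Or.inr (by simp)

theorem Quiver.Hom.toPath_injective {V : Type*} [Quiver V] {a b : V} :
    Function.Injective (Hom.toPath : (a ⟶ b) → Path a b) :=
  fun _ _ h => eq_of_heq (Path.hom_heq_of_cons_eq_cons h)

/-! ### Parallel paths and branches of a toupie quiver. -/

namespace IsToupie

variable {V : Type*} [Quiver V] {o w : V}

theorem source_ne_sink (h : IsToupie o w) (u : o ⟶ w) : o ≠ w := by
  rintro rfl
  simpa using h.acyclic o u.toPath

theorem isEmpty_hom_source (h : IsToupie o w) (v : V) : IsEmpty (v ⟶ o) :=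
  (h.source_iff o).2 rfl v

theorem isEmpty_sink_hom (h : IsToupie o w) (v : V) : IsEmpty (w ⟶ v) :=
  (h.sink_iff w).2 rfl v

theorem target_ne_source (h : IsToupie o w) {a b : V} (e : a ⟶ b) : b ≠ o := by
  rintro rfl
  exact (h.isEmpty_hom_source a).false e

theorem source_ne_of_hom (h : IsToupie o w) {a b : V} (e : a ⟶ b) : a ≠ w := by
  rintro rfl
  exact (h.isEmpty_sink_hom b).false e

theorem path_eq_nil (h : IsToupie o w) {v : V} (p : Path v v) : p = Path.nil :=
  Path.eq_nil_of_length_zero p (h.acyclic v p)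

theorem eq_of_path_source (h : IsToupie o w) {v : V} (p : Path v o) : v = o := by
  cases p with
  | nil => rfl
  | cons p e => exact absurd rfl (h.target_ne_source e)

/-- Two paths starting at a vertex other than the source are equal if they are parallel. -/
theorem subsingleton_path_of_ne_source (h : IsToupie o w) {v x : V} (hv : v ≠ o) :
    Subsingleton (Path v x) := by
  suffices H : ∀ (n : ℕ) (v x : V) (p q : Path v x), p.length = n → v ≠ o → p = q from
    ⟨fun p q => H _ v x p q rfl hv⟩
  intro n
  induction n with
  | zero =>
    intro v x p q hp _
    obtain rfl := Path.eq_of_length_zero p hp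
    rw [h.path_eq_nil p, h.path_eq_nil q]
  | succ n ih =>
    intro v x p q hp hv
    obtain ⟨c, e, p', hp', rfl⟩ := Path.eq_toPath_comp_of_length_eq_succ p hp
    have hq : q.length ≠ 0 := by
      intro hq
      obtain rfl := Path.eq_of_length_zero q hq
      have := h.acyclic _ (e.toPath.comp p')
      omega
    obtain ⟨m, hm⟩ := Nat.exists_eq_succ_of_ne_zero hq
    obtain ⟨c', f, q', -, rfl⟩ := Path.eq_toPath_comp_of_length_eq_succ q hm
    obtain ⟨U⟩ := h.out_unique v hv (h.source_ne_of_hom e)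
    have hef : (⟨c, e⟩ : Σ u : V, (v ⟶ u)) = ⟨c', f⟩ := Subsingleton.elim _ _
    cases hef
    rw [ih c x p' q' hp' (h.target_ne_source e)]

/-- Two paths ending at a vertex other than the sink are equal if they are parallel. -/
theorem subsingleton_path_of_ne_sink (h : IsToupie o w) {v x : V} (hv : v ≠ w) :
    Subsingleton (Path x v) := by
  suffices H : ∀ (v : V) (p : Path x v), v ≠ w → ∀ q : Path x v, p = q from
    ⟨fun p q => H v p hv q⟩
  intro v p
  induction p with
  | nil => intro _ q; exact (h.path_eq_nil q).symm
  | @cons b c p e ih =>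
    intro hc q
    cases q with
    | nil => exact h.path_eq_nil _
    | @cons b' _ q f =>
      obtain ⟨U⟩ := h.in_unique c (h.target_ne_source e) hc
      have hef : (⟨b, e⟩ : Σ u : V, (u ⟶ c)) = ⟨b', f⟩ := Subsingleton.elim _ _
      cases hef
      rw [ih (h.source_ne_of_hom e) q]

/-- This makes every corner of the algebra other than the one from source to sink at most
one-dimensional, so that derivations are diagonal there. -/
theorem subsingleton_path (h : IsToupie o w) {a b : V} (hab : ¬(a = o ∧ b = w)) :
    Subsingleton (Path a b) := by
  by_cases ha : a = o
  · exact h.subsingleton_path_of_ne_sink fun hb => hab ⟨ha, hb⟩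
  · exact h.subsingleton_path_of_ne_source ha

/-- The relation "reachable by a nontrivial path" is transitive and, by acyclicity, irreflexive.
Targets count as smaller, so induction walks towards the sink. -/
theorem wellFounded_hom [Finite V] (h : IsToupie o w) :
    WellFounded fun a b : V => Nonempty (b ⟶ a) := by
  let r : V → V → Prop := fun a b => ∃ p : Path b a, 0 < p.length
  have : Std.Irrefl r := ⟨fun a ⟨p, hp⟩ => by have := h.acyclic a p; omega⟩
  have : IsTrans V r := ⟨fun a b c ⟨p, hp⟩ ⟨q, hq⟩ => ⟨q.comp p, by simp; omega⟩⟩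
  exact Subrelation.wf (r := r) (fun ⟨e⟩ => ⟨e.toPath, by simp⟩)
    (Finite.wellFounded_of_trans_of_irrefl r)

theorem exists_path_sink [Finite V] (h : IsToupie o w) (v : V) : Nonempty (Path v w) := by
  induction v using h.wellFounded_hom.induction with
  | _ v ih =>
    by_cases hv : v = w
    · subst hv; exact ⟨Path.nil⟩
    · have := mt (h.sink_iff v).1 hv
      push Not at this
      obtain ⟨u, ⟨e⟩⟩ := this
      obtain ⟨p⟩ := ih u ⟨e⟩
      exact ⟨e.toPath.comp p⟩

theorem comp_first_inj (h : IsToupie o w) {u u' : V} {f : o ⟶ u} {f' : o ⟶ u'} {q : Path u w}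
    {q' : Path u' w} (he : (⟨o, u, f⟩ : QArrow V) = ⟨o, u', f'⟩) :
    f.toPath.comp q = f'.toPath.comp q' := by
  cases he
  rw [(h.subsingleton_path_of_ne_source (h.target_ne_source f)).elim q q']

/-- After its first arrow a branch has left the source, and from there the path to the sink is
unique. Functions on branches can therefore be stored on first arrows. -/
theorem isFirstArrow_unique (h : IsToupie o w) {e : QArrow V} {p q : Path o w}
    (hp : IsFirstArrow e p) (hq : IsFirstArrow e q) : p = q := by
  obtain ⟨u, f, p', rfl, rfl⟩ := hp
  obtain ⟨u', f', q', he, rfl⟩ := hq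
  exact h.comp_first_inj he

theorem finite_branches [Finite V] [∀ x y : V, Finite (x ⟶ y)] (h : IsToupie o w)
    (hne : o ≠ w) : Finite (Path o w) := by
  choose u f q hq using fun p : Path o w => p.exists_first hne
  refine Finite.of_injective (β := Σ u : V, (o ⟶ u)) (fun p => ⟨u p, f p⟩) fun p p' hpp => ?_
  rw [hq p, hq p']
  apply h.comp_first_inj
  have := congrArg (fun x : Σ u : V, (o ⟶ u) => (⟨o, x.1, x.2⟩ : QArrow V)) hpp
  exact this

end IsToupie

/-! ### The quotient by an admissible ideal: corners and coefficients of short paths. -/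

section Quotient

variable {k V : Type*} [Field k] [Quiver V] [Fintype V] [DecidableEq V]
  (I : Ideal (PathAlgebra k V)) [I.IsTwoSided]

namespace PathAlgebra

/-- The quotient map, as a linear map. -/
noncomputable def mkLin : PathAlgebra k V →ₗ[k] PathAlgebra k V ⧸ I :=
  (Ideal.Quotient.mkₐ k I).toLinearMap

theorem mkLin_ofPath {a b : V} (p : Path a b) : mkLin I (ofPath p) = pathClass I p := rfl

theorem mkLin_surjective : Function.Surjective (mkLin I) := Ideal.Quotient.mk_surjective

theorem mkLin_eq_zero {x : PathAlgebra k V} : mkLin I x = 0 ↔ x ∈ I :=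
  Ideal.Quotient.eq_zero_iff_mem

theorem mkLin_mul (x y : PathAlgebra k V) : mkLin I (x * y) = mkLin I x * mkLin I y := rfl

theorem map_eq_of_mkLin_eq {M : Type*} [AddCommGroup M] [Module k M]
    (f : PathAlgebra k V →ₗ[k] M) (hf : ∀ x ∈ I, f x = 0) {x y : PathAlgebra k V}
    (h : mkLin I x = mkLin I y) : f x = f y := by
  rw [← sub_eq_zero, ← map_sub]
  exact hf _ ((mkLin_eq_zero I).1 (by rw [map_sub, h, sub_self]))

/-- Descend a linear map to the quotient. -/
noncomputable def liftLin {M : Type*} [AddCommGroup M] [Module k M] (f : PathAlgebra k V →ₗ[k] M)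
    (hf : ∀ x ∈ I, f x = 0) : PathAlgebra k V ⧸ I →ₗ[k] M where
  -- The quotient is by an ideal rather than by a `k`-submodule, so the map goes through a chosen
  -- preimage; `map_eq_of_mkLin_eq` makes the choice irrelevant.
  toFun x := f (Function.surjInv (mkLin_surjective I) x)
  map_add' x y := by
    rw [← map_add]
    refine map_eq_of_mkLin_eq I f hf ?_
    simp only [map_add, Function.surjInv_eq (mkLin_surjective I)]
  map_smul' c x := by
    rw [RingHom.id_apply, ← map_smul]
    refine map_eq_of_mkLin_eq I f hf ?_
    simp only [map_smul, Function.surjInv_eq (mkLin_surjective I)]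

theorem liftLin_mk {M : Type*} [AddCommGroup M] [Module k M] (f : PathAlgebra k V →ₗ[k] M)
    (hf : ∀ x ∈ I, f x = 0) (x : PathAlgebra k V) : liftLin I f hf (mkLin I x) = f x :=
  map_eq_of_mkLin_eq I f hf (Function.surjInv_eq _ _)

theorem quot_hom_ext {M : Type*} [AddCommGroup M] [Module k M]
    {f g : PathAlgebra k V ⧸ I →ₗ[k] M}
    (h : ∀ (a b : V) (p : Path a b), f (pathClass I p) = g (pathClass I p)) : f = g := by
  have : f.comp (mkLin I) = g.comp (mkLin I) := hom_ext fun a b p => h a b p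
  refine LinearMap.ext fun x => ?_
  obtain ⟨x, rfl⟩ := mkLin_surjective I x
  exact LinearMap.congr_fun this x

theorem pathClass_mul {a b c : V} (p : Path a b) (q : Path b c) :
    pathClass I p * pathClass I q = pathClass I (p.comp q) := by
  rw [← mkLin_ofPath, ← mkLin_ofPath, ← mkLin_mul, ofPath_mul_ofPath, mkLin_ofPath]

theorem pathClass_mul_of_ne {a b b' c : V} (h : b' ≠ b) (p : Path a b) (q : Path b' c) :
    pathClass I p * pathClass I q = 0 := by
  rw [← mkLin_ofPath, ← mkLin_ofPath, ← mkLin_mul, ofPath_mul_ofPath_of_ne h, map_zero]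

/-- The vertex idempotents of the quotient. -/
noncomputable abbrev idem (v : V) : PathAlgebra k V ⧸ I := pathClass I (Path.nil : Path v v)

theorem idem_mul_pathClass {a b : V} (p : Path a b) : idem I a * pathClass I p = pathClass I p := by
  rw [pathClass_mul, Path.nil_comp]

theorem pathClass_mul_idem {a b : V} (p : Path a b) : pathClass I p * idem I b = pathClass I p := by
  rw [pathClass_mul, Path.comp_nil]

theorem idem_mul_idem (v : V) : idem I v * idem I v = idem I v := idem_mul_pathClass I _

theorem sum_idem : ∑ v, idem I v = 1 := by
  have : (1 : PathAlgebra k V ⧸ I) = mkLin I 1 := rfl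
  rw [this, one_def', map_sum]
  rfl

theorem pathClass_cons {a b c : V} (p : Path a b) (e : b ⟶ c) :
    pathClass I (p.cons e) = pathClass I p * pathClass I e.toPath :=
  (pathClass_mul I p e.toPath).symm

omit [I.IsTwoSided] in
/-- The corner spaces of the path algebra are spanned by paths. -/
theorem nil_mul_mul_nil_mem_span (a b : V) (x : PathAlgebra k V) :
    ofPath (Path.nil : Path a a) * x * ofPath (Path.nil : Path b b) ∈
      Submodule.span k (Set.range fun p : Path a b => (ofPath p : PathAlgebra k V)) := by
  set S := Submodule.span k (Set.range fun p : Path a b => (ofPath p : PathAlgebra k V))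
  let F : PathAlgebra k V →ₗ[k] PathAlgebra k V :=
    (LinearMap.mulRight k (ofPath (Path.nil : Path b b))).comp
      (LinearMap.mulLeft k (ofPath (Path.nil : Path a a)))
  -- Membership in the span is phrased as the vanishing of a linear map, which can be tested on
  -- paths.
  have key : S.mkQ.comp F = 0 := by
    apply hom_ext
    intro c d p
    have hF : F (ofPath p) =
      ofPath (Path.nil : Path a a) * ofPath p * ofPath (Path.nil : Path b b) := rfl
    rw [LinearMap.comp_apply, hF, LinearMap.zero_apply, Submodule.mkQ_apply,
      Submodule.Quotient.mk_eq_zero]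
    by_cases hc : c = a
    · subst hc
      rw [ofPath_mul_ofPath, Path.nil_comp]
      by_cases hd : b = d
      · subst hd
        rw [ofPath_mul_ofPath, Path.comp_nil]
        exact Submodule.subset_span ⟨p, rfl⟩
      · rw [ofPath_mul_ofPath_of_ne hd]; exact S.zero_mem
    · rw [ofPath_mul_ofPath_of_ne hc, zero_mul]; exact S.zero_mem
  exact (Submodule.Quotient.mk_eq_zero S).1 (LinearMap.congr_fun key x)

/-- The corner spaces of the quotient are spanned by paths. -/
theorem corner_mem_span (a b : V) (x : PathAlgebra k V ⧸ I) :
    idem I a * x * idem I b ∈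
      Submodule.span k (Set.range fun p : Path a b => pathClass I p) := by
  obtain ⟨x, rfl⟩ := mkLin_surjective I x
  have h := Submodule.mem_map_of_mem (f := mkLin I) (nil_mul_mul_nil_mem_span a b x)
  rw [Submodule.map_span, ← Set.range_comp] at h
  exact h

theorem corner_of_mem_span {a b : V} {x : PathAlgebra k V ⧸ I}
    (hx : x ∈ Submodule.span k (Set.range fun p : Path a b => pathClass I p)) :
    idem I a * x * idem I b = x := by
  induction hx using Submodule.span_induction with
  | mem x h => obtain ⟨p, rfl⟩ := h; simp only [idem_mul_pathClass, pathClass_mul_idem]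
  | zero => simp
  | add x y _ _ hx hy => rw [mul_add, add_mul, hx, hy]
  | smul c x _ hx => rw [mul_smul_comm, smul_mul_assoc, hx]

/-- The coefficient of a path. -/
noncomputable def pathCoeff {a b : V} (p : Path a b) : PathAlgebra k V →ₗ[k] k :=
  Finsupp.lapply (⟨a, b, p⟩ : QPath V)

theorem pathCoeff_ofPath_self {a b : V} (p : Path a b) :
    pathCoeff p (ofPath p : PathAlgebra k V) = 1 := by
  classical
  exact Finsupp.single_eq_same

theorem pathCoeff_ofPath_of_ne {a b c d : V} {p : Path a b} {q : Path c d}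
    (h : (⟨c, d, q⟩ : QPath V) ≠ ⟨a, b, p⟩) : pathCoeff p (ofPath q : PathAlgebra k V) = 0 := by
  classical
  exact Finsupp.single_eq_of_ne (by simpa using h.symm)

variable {I}

-- Admissibility puts `I` inside the span of paths of length at least two, which have no component
-- along a shorter path. Vertices and arrows thus keep well-defined coefficients in the quotient.
omit [I.IsTwoSided] in
theorem pathCoeff_eq_zero (hI : IsAdmissible I) {a b : V} {p : Path a b} (hp : p.length < 2)
    {x : PathAlgebra k V} (hx : x ∈ I) : pathCoeff p x = 0 := by
  have := hI.2 x hx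
  clear hx
  induction this using Submodule.span_induction with
  | mem y hy =>
    obtain ⟨c, d, q, hq, rfl⟩ := hy
    refine pathCoeff_ofPath_of_ne fun h => ?_
    cases h
    omega
  | zero => simp
  | add x y _ _ hx hy => simp [hx, hy]
  | smul c x _ hx => simp [hx]

/-- The coefficient of a path of length at most one in the quotient by an admissible ideal. -/
noncomputable def coeff (hI : IsAdmissible I) {a b : V} (p : Path a b) (hp : p.length < 2) :
    PathAlgebra k V ⧸ I →ₗ[k] k :=
  liftLin I (pathCoeff p) fun _ hx => pathCoeff_eq_zero hI hp hx

theorem coeff_self (hI : IsAdmissible I) {a b : V} (p : Path a b) (hp : p.length < 2) :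
    coeff hI p hp (pathClass I p) = 1 := by
  rw [← mkLin_ofPath, coeff, liftLin_mk, pathCoeff_ofPath_self]

theorem coeff_of_ne (hI : IsAdmissible I) {a b c d : V} {p : Path a b} (hp : p.length < 2)
    {q : Path c d} (h : (⟨c, d, q⟩ : QPath V) ≠ ⟨a, b, p⟩) :
    coeff hI p hp (pathClass I q) = 0 := by
  rw [← mkLin_ofPath, coeff, liftLin_mk, pathCoeff_ofPath_of_ne h]

/-- The coefficient of a vertex idempotent. -/
noncomputable def vcoeff (hI : IsAdmissible I) (v : V) : PathAlgebra k V ⧸ I →ₗ[k] k :=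
  coeff hI (Path.nil : Path v v) (by simp)

theorem vcoeff_nil (hI : IsAdmissible I) (v : V) : vcoeff hI v (idem I v) = 1 :=
  coeff_self hI _ _

theorem vcoeff_of_ne (hI : IsAdmissible I) {v c d : V} {q : Path c d}
    (h : (⟨c, d, q⟩ : QPath V) ≠ ⟨v, v, Path.nil⟩) : vcoeff hI v (pathClass I q) = 0 :=
  coeff_of_ne hI _ h

/-- The coefficient of an arrow. -/
noncomputable def acoeff (hI : IsAdmissible I) {a b : V} (e : a ⟶ b) :
    PathAlgebra k V ⧸ I →ₗ[k] k :=
  coeff hI e.toPath (by simp)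

theorem acoeff_self (hI : IsAdmissible I) {a b : V} (e : a ⟶ b) :
    acoeff hI e (pathClass I e.toPath) = 1 :=
  coeff_self hI _ _

theorem acoeff_of_ne (hI : IsAdmissible I) {a b c d : V} {e : a ⟶ b} {q : Path c d}
    (h : (⟨c, d, q⟩ : QPath V) ≠ ⟨a, b, e.toPath⟩) : acoeff hI e (pathClass I q) = 0 :=
  coeff_of_ne hI _ h

/-- Multiplying an arrow by a nontrivial path gives zero or a path of length at least two, so only
the trivial path at `a` contributes. Together with the mirror statement this computes inner
derivations on arrows. -/
theorem acoeff_mul_toPath (hI : IsAdmissible I) {a b : V} (e f : a ⟶ b)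
    (x : PathAlgebra k V ⧸ I) :
    acoeff hI f (x * pathClass I e.toPath) =
      vcoeff hI a x * acoeff hI f (pathClass I e.toPath) := by
  have : (acoeff hI f).comp (LinearMap.mulRight k (pathClass I e.toPath)) =
      acoeff hI f (pathClass I e.toPath) • vcoeff hI a := by
    apply quot_hom_ext
    intro c d p
    change acoeff hI f (pathClass I p * pathClass I e.toPath) =
      acoeff hI f (pathClass I e.toPath) • vcoeff hI a (pathClass I p)
    by_cases hd : a = d
    · subst hd
      rw [pathClass_mul]
      cases p with
      | nil => rw [vcoeff_nil, Path.nil_comp]; simp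
      | cons p g =>
        rw [acoeff_of_ne, vcoeff_of_ne]
        · simp
        · intro h
          have := congrArg (fun x : QPath V => x.2.2.length) h
          simp at this
        · intro h
          have := congrArg (fun x : QPath V => x.2.2.length) h
          simp at this
    · rw [pathClass_mul_of_ne I hd, map_zero, vcoeff_of_ne, smul_zero]
      intro h
      cases h
      exact hd rfl
  have := LinearMap.congr_fun this x
  simpa [mul_comm] using this

theorem acoeff_toPath_mul (hI : IsAdmissible I) {a b : V} (e f : a ⟶ b)
    (x : PathAlgebra k V ⧸ I) :
    acoeff hI f (pathClass I e.toPath * x) =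
      vcoeff hI b x * acoeff hI f (pathClass I e.toPath) := by
  have : (acoeff hI f).comp (LinearMap.mulLeft k (pathClass I e.toPath)) =
      acoeff hI f (pathClass I e.toPath) • vcoeff hI b := by
    apply quot_hom_ext
    intro c d p
    change acoeff hI f (pathClass I e.toPath * pathClass I p) =
      acoeff hI f (pathClass I e.toPath) • vcoeff hI b (pathClass I p)
    by_cases hd : c = b
    · subst hd
      rw [pathClass_mul]
      cases p with
      | nil => rw [vcoeff_nil, Path.comp_nil]; simp
      | cons p g =>
        rw [acoeff_of_ne, vcoeff_of_ne]
        · simp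
        · intro h
          have := congrArg (fun x : QPath V => x.2.2.length) h
          simp at this
        · intro h
          have := congrArg (fun x : QPath V => x.2.2.length) h
          simp [Path.length_comp] at this
    · rw [pathClass_mul_of_ne I hd, map_zero, vcoeff_of_ne, smul_zero]
      intro h
      cases h
      exact hd rfl
  have := LinearMap.congr_fun this x
  simpa [mul_comm] using this

end PathAlgebra

end Quotient

/-! ### Reduced row echelon form and the diagonal operators preserving a subspace. -/

section EchelonForm

variable {k ι : Type*} [Field k] [LinearOrder ι]

/-- Gaussian elimination by descending induction on the pivot: normalise a vector leading at `i`,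
then clear its entries at the later pivots with the rows already reduced. -/
theorem exists_isReducedRow [Finite ι] (R : Submodule k (ι →₀ k)) (i : ι) (hi : IsPivot R i) :
    ∃ v ∈ R, v i = 1 ∧ (∀ j < i, v j = 0) ∧ ∀ j, j ≠ i → IsPivot R j → v j = 0 := by
  classical
  have := Fintype.ofFinite ι
  induction i using (Finite.wellFounded_of_trans_of_irrefl (α := ι) (· > ·)).induction with
  | _ i ih =>
    choose! ρ hρ using ih
    obtain ⟨v, hvR, hvi, hv⟩ := hi
    set S : Finset ι := Finset.univ.filter fun j => i < j ∧ IsPivot R j with hS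
    set v₁ := (v i)⁻¹ • v with hv₁
    have hmem : ∀ j ∈ S, i < j ∧ IsPivot R j := by simp [hS]
    -- Each correcting row starts strictly after `i`, so the leading part of `v₁` is untouched.
    have hlow : ∀ l, l ≤ i → (∑ j ∈ S, v₁ j • ρ j) l = 0 := by
      intro l hl
      rw [Finsupp.finsetSum_apply]
      refine Finset.sum_eq_zero fun j hj => ?_
      obtain ⟨hij, hj⟩ := hmem j hj
      simp [(hρ j hij hj).2.2.1 l (hl.trans_lt hij)]
    refine ⟨v₁ - ∑ j ∈ S, v₁ j • ρ j, ?_, ?_, ?_, ?_⟩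
    · refine R.sub_mem (R.smul_mem _ hvR) (R.sum_mem fun j hj => R.smul_mem _ ?_)
      exact (hρ j (hmem j hj).1 (hmem j hj).2).1
    · rw [Finsupp.sub_apply, hlow i le_rfl]
      simp [hv₁, hvi]
    · intro j hj
      rw [Finsupp.sub_apply, hlow j hj.le]
      simp [hv₁, hv j hj]
    · intro j hj hjp
      rcases lt_or_gt_of_ne hj with hlt | hgt
      · rw [Finsupp.sub_apply, hlow j hlt.le]
        simp [hv₁, hv j hlt]
      · rw [Finsupp.sub_apply, Finsupp.finsetSum_apply, Finset.sum_eq_single j]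
        · simp [(hρ j hgt hjp).2.1]
        · intro l hl hlj
          simp [(hρ l (hmem l hl).1 (hmem l hl).2).2.2.2 j hlj.symm hjp]
        · intro h
          exact absurd (by simp [hS, hgt, hjp]) h

/-- The least index in the support of a nonzero vector of `R` would itself be a pivot. -/
theorem eq_zero_of_pivots {R : Submodule k (ι →₀ k)} {v : ι →₀ k} (hv : v ∈ R)
    (h : ∀ i, IsPivot R i → v i = 0) : v = 0 := by
  by_contra hne
  have hs : v.support.Nonempty := Finsupp.support_nonempty_iff.2 hne
  have hmin := v.support.min'_mem hs
  rw [Finsupp.mem_support_iff] at hmin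
  refine hmin (h _ ⟨v, hv, hmin, fun j hj => ?_⟩)
  by_contra hj0
  exact (Finset.min'_le _ j (Finsupp.mem_support_iff.2 hj0)).not_gt hj

/-- A subspace is spanned by its reduced rows. -/
theorem mem_span_isReducedRow [Finite ι] {R : Submodule k (ι →₀ k)} {v : ι →₀ k} (hv : v ∈ R) :
    v ∈ Submodule.span k {ρ | IsReducedRow R ρ} := by
  classical
  have := Fintype.ofFinite ι
  choose! ρ hρ using exists_isReducedRow R
  set S : Finset ι := Finset.univ.filter fun j => IsPivot R j with hS
  have hmem : ∀ j ∈ S, IsPivot R j := by simp [hS]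
  have : v - ∑ j ∈ S, v j • ρ j = 0 := by
    apply eq_zero_of_pivots (R := R)
    · exact R.sub_mem hv (R.sum_mem fun j hj => R.smul_mem _ (hρ j (hmem j hj)).1)
    · intro i hi
      rw [Finsupp.sub_apply, Finsupp.finsetSum_apply, Finset.sum_eq_single i]
      · simp [(hρ i hi).2.1]
      · intro l hl hli
        simp [(hρ l (hmem l hl)).2.2.2 i hli.symm hi]
      · intro h
        exact absurd (by simp [hS, hi]) h
  rw [sub_eq_zero.1 this]
  refine Submodule.sum_mem _ fun j hj => Submodule.smul_mem _ _ (Submodule.subset_span ?_)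
  obtain ⟨h1, h2⟩ := hρ j (hmem j hj)
  exact ⟨h1, j, h2⟩

/-- The subspace `R` is stable under the diagonal matrix with entries `f`. -/
def IsDiagStable (R : Submodule k (ι →₀ k)) (f : ι → k) : Prop :=
  ∀ c ∈ R, ∃ c' ∈ R, ∀ i, c' i = f i * c i

/-- Such an `f` merely rescales each reduced row, and the reduced rows span. -/
theorem isDiagStable_of_rows [Finite ι] {R : Submodule k (ι →₀ k)} {f : ι → k}
    (h : ∀ ρ, IsReducedRow R ρ → ∀ i j, ρ i ≠ 0 → ρ j ≠ 0 → f i = f j) : IsDiagStable R f := by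
  intro c hc
  induction mem_span_isReducedRow hc using Submodule.span_induction with
  | mem ρ hρ =>
    obtain ⟨i, hi, -⟩ := hρ.2
    refine ⟨f i • ρ, R.smul_mem _ hρ.1, fun j => ?_⟩
    by_cases hj : ρ j = 0
    · simp [hj]
    · rw [h ρ hρ j i hj (by rw [hi]; exact one_ne_zero)]; rfl
  | zero => exact ⟨0, R.zero_mem, by simp⟩
  | add x y hx hy ihx ihy =>
    have hsub : ∀ x ∈ Submodule.span k {ρ | IsReducedRow R ρ}, x ∈ R := fun x hx =>
      Submodule.span_le.2 (fun ρ (hρ : IsReducedRow R ρ) => hρ.1) hx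
    obtain ⟨x', hx', hx''⟩ := ihx (hsub x hx)
    obtain ⟨y', hy', hy''⟩ := ihy (hsub y hy)
    exact ⟨x' + y', R.add_mem hx' hy', fun i => by simp [hx'', hy'', mul_add]⟩
  | smul a x hx ihx =>
    have hsub : ∀ x ∈ Submodule.span k {ρ | IsReducedRow R ρ}, x ∈ R := fun x hx =>
      Submodule.span_le.2 (fun ρ (hρ : IsReducedRow R ρ) => hρ.1) hx
    obtain ⟨x', hx', hx''⟩ := ihx (hsub x hx)
    exact ⟨a • x', R.smul_mem _ hx', fun i => by simp [hx'', mul_left_comm]⟩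

/-- A reduced row `ρ` with pivot `l` is zero at the other pivots, hence so is `f · ρ`. Then `f · ρ -
f l • ρ` is a vector of `R` vanishing at all pivots, so it is zero. This converse to
`isDiagStable_of_rows` is where reducedness of the rows matters. -/
theorem IsDiagStable.eq_of_row {R : Submodule k (ι →₀ k)} {f : ι → k} (h : IsDiagStable R f)
    {ρ : ι →₀ k} (hρ : IsReducedRow R ρ) {i j : ι} (hi : ρ i ≠ 0) (hj : ρ j ≠ 0) : f i = f j := by
  obtain ⟨hR, l, hl, -, hlp⟩ := hρ
  obtain ⟨c, hc, hcf⟩ := h ρ hR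
  have h0 : c - f l • ρ = 0 := by
    apply eq_zero_of_pivots (R.sub_mem hc (R.smul_mem _ hR))
    intro m hm
    by_cases hml : m = l
    · subst hml; simp [hcf]
    · simp [hcf, hlp m hml hm]
  have key : ∀ m, ρ m ≠ 0 → f m = f l := by
    intro m hm
    have := DFunLike.congr_fun h0 m
    simp only [Finsupp.sub_apply, hcf, Finsupp.smul_apply, smul_eq_mul, ← sub_mul,
      Finsupp.zero_apply, mul_eq_zero, hm, or_false, sub_eq_zero] at this
    exact this
  rw [key i hi, key j hj]

end EchelonForm

/-! ### Solvable ideals, and the radical under a surjection onto `sl`. -/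

section Lie

open LieAlgebra

variable {k : Type*} [Field k]

/-- The special linear Lie algebra in characteristic zero has trivial radical. -/
theorem hasTrivialRadical_sl (n : Type*) [Fintype n] [DecidableEq n] [CharZero k] :
    HasTrivialRadical k (SpecialLinear.sl n k) := by
  rw [hasTrivialRadical_iff_no_abelian_ideals]
  intro K hK
  rw [eq_bot_iff]
  intro x hx
  rw [LieSubmodule.mem_bot]
  -- In an abelian ideal `⁅x, ⁅x, y⁆⁆ = 0` for every `y`; it is enough to test this on elementary
  -- matrices.
  have key : ∀ y : SpecialLinear.sl n k,
      x.1 * (x.1 * y.1 - y.1 * x.1) - (x.1 * y.1 - y.1 * x.1) * x.1 = 0 := by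
    intro y
    have hxy : ⁅x, y⁆ ∈ K := lie_mem_left k _ K x y hx
    have h0 := hK.trivial ⟨x, hx⟩ ⟨⁅x, y⁆, hxy⟩
    have h1 : ⁅x, ⁅x, y⁆⁆ = 0 := congrArg Subtype.val h0
    have h2 := congrArg Subtype.val h1
    exact h2
  have key2 : ∀ i j, i ≠ j → ∀ a b,
      (x.1 * (x.1 * Matrix.single i j 1 - Matrix.single i j 1 * x.1) -
        (x.1 * Matrix.single i j 1 - Matrix.single i j 1 * x.1) * x.1 : Matrix n n k) a b = 0 := by
    intro i j hij a b
    have := key (SpecialLinear.single i j hij 1)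
    rw [SpecialLinear.val_single] at this
    rw [this]; rfl
  have hoff : ∀ i j, i ≠ j → x.1 i j = 0 := by
    intro i j hij
    -- For `y = E_ji` the entry at `(i, j)` is `-2 x_ij²`, because the terms in `x²` do not reach
    -- it.
    have h1 := key2 j i hij.symm i j
    simp only [mul_sub, sub_mul, Matrix.sub_apply, ← Matrix.mul_assoc] at h1
    rw [Matrix.mul_single_apply_of_ne _ _ _ _ _ hij.symm] at h1
    simp [Matrix.mul_apply, Matrix.single_apply, ite_and, hij.symm] at h1
    have : (2 : k) * (x.1 i j * x.1 i j) = 0 := by linear_combination -h1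
    simpa using this
  have hdiag : x.1 = Matrix.diagonal fun i => x.1 i i := by
    ext i j
    by_cases hij : i = j
    · subst hij; simp
    · simp [hij, hoff]
  have hconst : ∀ i j, x.1 i i = x.1 j j := by
    intro i j
    by_cases hij : i = j
    · rw [hij]
    -- With `x` diagonal, the entry for `E_ij` is `(x_ii - x_jj)²`. So `x` is scalar, and the trace
    -- condition in characteristic zero kills it.
    have h1 := key2 i j hij i j
    rw [hdiag] at h1
    simp [mul_sub, sub_mul, Matrix.diagonal_mul, Matrix.mul_diagonal] at h1
    have : (x.1 i i - x.1 j j) ^ 2 = 0 := by linear_combination h1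
    exact sub_eq_zero.1 (pow_eq_zero_iff (two_ne_zero) |>.1 this)
  have htr : x.1.trace = 0 := x.2
  apply Subtype.ext
  ext i j
  by_cases hij : i = j
  · subst hij
    rw [Matrix.trace] at htr
    simp only [Matrix.diag_apply, hconst _ i, Finset.sum_const, Finset.card_univ,
      nsmul_eq_mul, mul_eq_zero, Nat.cast_eq_zero] at htr
    have : Nonempty n := ⟨i⟩
    simpa using htr
  · exact hoff i j hij

/-- A Lie ideal is solvable if its brackets lie in an abelian Lie ideal. -/
theorem isSolvable_of_lie_mem {H : Type*} [LieRing H] [LieAlgebra k H] {L Z : LieIdeal k H}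
    (h₁ : ∀ x ∈ L, ∀ y ∈ L, ⁅x, y⁆ ∈ Z) (h₂ : ∀ x ∈ Z, ∀ y ∈ Z, ⁅x, y⁆ = 0) :
    IsSolvable L := by
  have hZ : ⁅Z, Z⁆ = ⊥ := by
    rw [LieSubmodule.lie_eq_bot_iff]
    exact h₂
  have hL : ⁅L, L⁆ ≤ Z := by
    rw [LieSubmodule.lie_le_iff]
    exact h₁
  refine IsSolvable.mk (R := k) (k := 2) ?_
  rw [LieIdeal.derivedSeries_eq_bot_iff, derivedSeriesOfIdeal_succ, derivedSeriesOfIdeal_succ,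
    derivedSeriesOfIdeal_zero, eq_bot_iff, ← hZ]
  exact LieSubmodule.mono_lie hL hL

/-- Under a surjection the image of a solvable ideal is again a solvable ideal, hence lies in the
zero radical of `S`. Surjectivity is what lets images commute with brackets of ideals. -/
theorem radical_le_ker {H S : Type*} [LieRing H] [LieAlgebra k H] [LieRing S] [LieAlgebra k S]
    [HasTrivialRadical k S] (f : H →ₗ⁅k⁆ S) (hf : Function.Surjective f) :
    radical k H ≤ f.ker := by
  refine sSup_le fun J (hJ : IsSolvable J) => ?_
  have hmap : IsSolvable (J.map f) := by
    obtain ⟨n, hn⟩ := hJ.solvable (R := k)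
    rw [LieIdeal.derivedSeries_eq_bot_iff] at hn
    have hD : ∀ m, derivedSeriesOfIdeal k S m (J.map f) =
        (derivedSeriesOfIdeal k H m J).map f := by
      intro m
      induction m with
      | zero => rfl
      | succ m ih =>
        rw [derivedSeriesOfIdeal_succ, derivedSeriesOfIdeal_succ, ih,
          LieIdeal.map_bracket_eq f hf]
    refine IsSolvable.mk (R := k) (k := n) ?_
    rw [LieIdeal.derivedSeries_eq_bot_iff, hD, hn, LieIdeal.map_eq_bot_iff]
    exact bot_le
  have : J.map f ≤ radical k S := le_sSup hmap
  rw [HasTrivialRadical.radical_eq_bot] at this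
  rw [← LieIdeal.map_eq_bot_iff]
  exact le_bot_iff.1 this

end Lie

/-! ### Cocycles and inner derivations. -/

section Inner

variable {k A : Type*} [Field k] [Ring A] [Algebra k A]

/-- Shortcut instance. -/
@[reducible] def hochschildCocycle₁.addCommGroup : AddCommGroup (hochschildCocycle₁ k A) :=
  LieRing.toAddCommGroup

attribute [local instance] hochschildCocycle₁.addCommGroup

/-- Shortcut instance. -/
@[reducible] def hochschildCocycle₁.addCommMonoid : AddCommMonoid (hochschildCocycle₁ k A) :=
  AddCommGroup.toAddCommMonoid

attribute [local instance] hochschildCocycle₁.addCommMonoid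

/-- Shortcut instance. -/
@[reducible] def hochschildCocycle₁.module : Module k (hochschildCocycle₁ k A) :=
  LieAlgebra.toModule

attribute [local instance] hochschildCocycle₁.module

/-- Shortcut instance. -/
@[reducible] def hochschildCocycle₁.smul : SMul k (hochschildCocycle₁ k A) :=
  hochschildCocycle₁.module.toSMul

/-- Shortcut instance. -/
@[reducible] def hochschildCocycle₁.add : Add (hochschildCocycle₁ k A) :=
  hochschildCocycle₁.addCommGroup.toAdd

/-- Shortcut instance. -/
@[reducible] def hochschildCocycle₁.sub : Sub (hochschildCocycle₁ k A) :=
  hochschildCocycle₁.addCommGroup.toSub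

/-- Shortcut instance. -/
@[reducible] def hochschildCocycle₁.zero : Zero (hochschildCocycle₁ k A) :=
  hochschildCocycle₁.addCommGroup.toZero

/-- Shortcut instance. -/
@[reducible] def hochschildCocycle₁.bracket :
    Bracket (hochschildCocycle₁ k A) (hochschildCocycle₁ k A) :=
  LieRing.toBracket

theorem hochschildCocycle₁.map_mul (D : hochschildCocycle₁ k A) (x y : A) :
    D.1 (x * y) = x * D.1 y + D.1 x * y := D.2 x y

/-- The inner derivation `x ↦ a x - x a`. -/
def innerCocycle (a : A) : hochschildCocycle₁ k A :=
  ⟨LinearMap.mulLeft k a - LinearMap.mulRight k a, fun x y => by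
    simp only [LinearMap.sub_apply, LinearMap.mulLeft_apply, LinearMap.mulRight_apply]
    noncomm_ring⟩

theorem innerCocycle_apply (a x : A) :
    (innerCocycle a : hochschildCocycle₁ k A).1 x = a * x - x * a := rfl

theorem innerCocycle_mem (a : A) :
    (innerCocycle a : hochschildCocycle₁ k A) ∈ hochschildCoboundary₁ k A :=
  ⟨a, fun _ => rfl⟩

theorem mem_hochschildCoboundary₁ {D : hochschildCocycle₁ k A} :
    D ∈ hochschildCoboundary₁ k A ↔ ∃ a, D = innerCocycle a := by
  constructor
  · rintro ⟨a, ha⟩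
    exact ⟨a, Subtype.ext (LinearMap.ext ha)⟩
  · rintro ⟨a, rfl⟩
    exact innerCocycle_mem a

end Inner

attribute [local instance] hochschildCocycle₁.addCommGroup hochschildCocycle₁.addCommMonoid
  hochschildCocycle₁.module hochschildCocycle₁.smul hochschildCocycle₁.add hochschildCocycle₁.sub
  hochschildCocycle₁.zero hochschildCocycle₁.bracket

/-! ### Path weights, corners, and cocycles normalised at the vertices. -/

namespace PathAlgebra

section Weight

variable {k V : Type*} [Field k] [Quiver V]

/-- The sum of the weights of the arrows of a path. -/
def pathWeight (f : QArrow V → k) {a : V} : ∀ {b : V}, Path a b → k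
  | _, .nil => 0
  | _, .cons p e => pathWeight f p + f ⟨_, _, e⟩

theorem pathWeight_nil (f : QArrow V → k) (a : V) : pathWeight f (Path.nil : Path a a) = 0 := rfl

theorem pathWeight_cons (f : QArrow V → k) {a b c : V} (p : Path a b) (e : b ⟶ c) :
    pathWeight f (p.cons e) = pathWeight f p + f ⟨_, _, e⟩ := rfl

theorem pathWeight_toPath (f : QArrow V → k) {a b : V} (e : a ⟶ b) :
    pathWeight f e.toPath = f ⟨_, _, e⟩ := by
  rw [Hom.toPath, pathWeight_cons, pathWeight_nil, zero_add]

theorem pathWeight_comp (f : QArrow V → k) {a b c : V} (p : Path a b) (q : Path b c) :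
    pathWeight f (p.comp q) = pathWeight f p + pathWeight f q := by
  induction q with
  | nil => rw [Path.comp_nil, pathWeight_nil, add_zero]
  | cons q e ih => rw [Path.comp_cons, pathWeight_cons, pathWeight_cons, ih, add_assoc]

end Weight

variable {k V : Type*} [Field k] [Quiver V] [Fintype V] [DecidableEq V]
  (I : Ideal (PathAlgebra k V)) [I.IsTwoSided]

/-- The span of the classes of the paths from `a` to `b`. -/
noncomputable def corner (a b : V) : Submodule k (PathAlgebra k V ⧸ I) :=
  Submodule.span k (Set.range fun p : Path a b => pathClass I p)

theorem mem_corner_iff {a b : V} {x : PathAlgebra k V ⧸ I} :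
    x ∈ corner I a b ↔ idem I a * x * idem I b = x :=
  ⟨fun h => corner_of_mem_span I h, fun h => h ▸ corner_mem_span I a b x⟩

theorem pathClass_mem_corner {a b : V} (p : Path a b) : pathClass I p ∈ corner I a b :=
  Submodule.subset_span ⟨p, rfl⟩

variable {I}

theorem idem_mul_of_mem_corner {a b : V} {x : PathAlgebra k V ⧸ I} (hx : x ∈ corner I a b) :
    idem I a * x = x := by
  have h := (mem_corner_iff I).1 hx
  rw [← h, mul_assoc, ← mul_assoc (idem I a), ← mul_assoc (idem I a), idem_mul_idem,
    mul_assoc]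

theorem mul_idem_of_mem_corner {a b : V} {x : PathAlgebra k V ⧸ I} (hx : x ∈ corner I a b) :
    x * idem I b = x := by
  have h := (mem_corner_iff I).1 hx
  rw [← h, mul_assoc, idem_mul_idem]

theorem pathClass_mul_eq_zero_of_mem_corner {a b c d : V} (h : c ≠ b) (p : Path a b)
    {x : PathAlgebra k V ⧸ I} (hx : x ∈ corner I c d) : pathClass I p * x = 0 := by
  rw [← idem_mul_of_mem_corner hx, ← mul_assoc, pathClass_mul_of_ne I h, zero_mul]

theorem mul_pathClass_eq_zero_of_mem_corner {a b c d : V} (h : c ≠ b) (p : Path c d)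
    {x : PathAlgebra k V ⧸ I} (hx : x ∈ corner I a b) : x * pathClass I p = 0 := by
  rw [← mul_idem_of_mem_corner hx, mul_assoc, pathClass_mul_of_ne I h, mul_zero]

theorem exists_smul_of_mem_corner {a b : V} [Subsingleton (Path a b)] (p : Path a b)
    {x : PathAlgebra k V ⧸ I} (hx : x ∈ corner I a b) : ∃ c : k, x = c • pathClass I p := by
  have : Set.range (fun p : Path a b => pathClass I p) = {pathClass I p} := by
    ext y
    constructor
    · rintro ⟨q, rfl⟩; rw [Subsingleton.elim q p]; rfl
    · rintro rfl; exact ⟨p, rfl⟩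
  rw [corner, this, Submodule.mem_span_singleton] at hx
  obtain ⟨c, hc⟩ := hx
  exact ⟨c, hc.symm⟩

variable (I) in
/-- The cocycles that vanish on the vertex idempotents. -/
noncomputable def normalCocycles : Submodule k (hochschildCocycle₁ k (PathAlgebra k V ⧸ I)) where
  carrier := {D | ∀ v, D.1 (idem I v) = 0}
  add_mem' {D E} hD hE v := by
    change D.1 _ + E.1 _ = 0
    rw [hD v, hE v, add_zero]
  zero_mem' _ := rfl
  smul_mem' c D hD v := by
    change c • D.1 _ = 0
    rw [hD v, smul_zero]

/-- Every cocycle is cohomologous to one that vanishes on the vertex idempotents. -/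
theorem exists_sub_inner_mem_normalCocycles (D : hochschildCocycle₁ k (PathAlgebra k V ⧸ I)) :
    ∃ a, D - innerCocycle a ∈ normalCocycles I := by
  -- With `a = ∑ D(e_i) e_i`, the Leibniz rule for `e_v e_i` gives `e_v a = D(e_v) e_v - D(e_v)`.
  -- Since also `a e_v = D(e_v) e_v`, the inner derivation of `a` takes the value `D(e_v)` at `e_v`.
  refine ⟨∑ i, D.1 (idem I i) * idem I i, fun v => ?_⟩
  have h1 : (∑ i, D.1 (idem I i) * idem I i) * idem I v = D.1 (idem I v) * idem I v := by
    rw [Finset.sum_mul, Finset.sum_eq_single v]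
    · rw [mul_assoc, idem_mul_idem]
    · intro i _ hi
      rw [mul_assoc, idem, idem, pathClass_mul_of_ne I hi.symm, mul_zero]
    · simp
  have h2 : idem I v * ∑ i, D.1 (idem I i) * idem I i =
      D.1 (idem I v) * idem I v - D.1 (idem I v) := by
    have hterm : ∀ i, idem I v * (D.1 (idem I i) * idem I i) =
        (if i = v then D.1 (idem I v) * idem I v else 0) - D.1 (idem I v) * idem I i := by
      intro i
      by_cases hi : i = v
      · subst hi
        have h := hochschildCocycle₁.map_mul D (idem I i) (idem I i)
        rw [idem_mul_idem] at h
        have h' := congrArg (· * idem I i) h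
        simp only [add_mul, mul_assoc, idem_mul_idem] at h'
        rw [if_pos rfl, sub_self]
        simpa using h'
      · have h := hochschildCocycle₁.map_mul D (idem I v) (idem I i)
        rw [idem, idem, pathClass_mul_of_ne I hi, map_zero] at h
        have h' := congrArg (· * idem I i) h
        simp only [add_mul, mul_assoc, idem_mul_idem, zero_mul] at h'
        rw [if_neg hi, zero_sub]
        exact eq_neg_of_add_eq_zero_left h'.symm
    rw [Finset.mul_sum, Finset.sum_congr rfl fun i _ => hterm i, Finset.sum_sub_distrib,
      Finset.sum_ite_eq' Finset.univ v, if_pos (Finset.mem_univ v), ← Finset.mul_sum, sum_idem,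
      mul_one]
  change D.1 _ - (innerCocycle _ : hochschildCocycle₁ k (PathAlgebra k V ⧸ I)).1 _ = 0
  rw [innerCocycle_apply, h1, h2]
  abel

section Normal

variable {D E : hochschildCocycle₁ k (PathAlgebra k V ⧸ I)}

/-- Since `D` kills both idempotents, differentiating `x = e_a x e_b` moves `D` onto the middle
factor alone. -/
theorem apply_mem_corner (hD : D ∈ normalCocycles I) {a b : V} {x : PathAlgebra k V ⧸ I}
    (hx : x ∈ corner I a b) : D.1 x ∈ corner I a b := by
  rw [mem_corner_iff] at hx ⊢
  conv_rhs => rw [← hx, hochschildCocycle₁.map_mul, hochschildCocycle₁.map_mul, hD a, hD b]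
  simp

theorem normalCocycles_ext (hD : D ∈ normalCocycles I) (hE : E ∈ normalCocycles I)
    (h : ∀ (a b : V) (e : a ⟶ b), D.1 (pathClass I e.toPath) = E.1 (pathClass I e.toPath)) :
    D = E := by
  apply Subtype.ext
  apply quot_hom_ext
  intro a b p
  induction p with
  | nil => rw [hD a, hE a]
  | cons p e ih =>
    rw [pathClass_cons, hochschildCocycle₁.map_mul, hochschildCocycle₁.map_mul, ih, h]

theorem lie_apply (D E : hochschildCocycle₁ k (PathAlgebra k V ⧸ I)) (x : PathAlgebra k V ⧸ I) :
    (⁅D, E⁆ : hochschildCocycle₁ k (PathAlgebra k V ⧸ I)).1 x = D.1 (E.1 x) - E.1 (D.1 x) := rfl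

theorem lie_mem_normalCocycles (hD : D ∈ normalCocycles I) (hE : E ∈ normalCocycles I) :
    ⁅D, E⁆ ∈ normalCocycles I := fun v => by
  rw [lie_apply, hD v, hE v, map_zero, map_zero, sub_zero]

end Normal

/-- A linear map on the path algebra that satisfies the Leibniz rule on paths and kills the ideal
induces a cocycle of the quotient. -/
theorem exists_cocycle (F : PathAlgebra k V →ₗ[k] PathAlgebra k V ⧸ I) (hF : ∀ x ∈ I, F x = 0)
    (hends : ∀ (a b : V) (p : Path a b), F (ofPath p) ∈ corner I a b)
    (hcomp : ∀ (a b c : V) (p : Path a b) (q : Path b c),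
      F (ofPath (p.comp q)) = pathClass I p * F (ofPath q) + F (ofPath p) * pathClass I q) :
    ∃ D ∈ normalCocycles I, ∀ (a b : V) (p : Path a b),
      D.1 (pathClass I p) = F (ofPath p) := by
  set G := liftLin I F hF with hG
  have hGp : ∀ (a b : V) (p : Path a b), G (pathClass I p) = F (ofPath p) := fun a b p => by
    rw [hG, ← mkLin_ofPath, liftLin_mk]
  -- For paths that do not compose, both terms on the right vanish because `F` respects end points.
  -- The rule is then extended linearly in each factor.
  have key : ∀ (a b c d : V) (p : Path a b) (q : Path c d),
      G (pathClass I p * pathClass I q) =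
        pathClass I p * G (pathClass I q) + G (pathClass I p) * pathClass I q := by
    intro a b c d p q
    rw [hGp, hGp]
    by_cases h : c = b
    · subst h
      rw [pathClass_mul, hGp, hcomp]
    · rw [pathClass_mul_of_ne I h, map_zero, pathClass_mul_eq_zero_of_mem_corner h p (hends _ _ q),
        mul_pathClass_eq_zero_of_mem_corner h q (hends _ _ p), add_zero]
  have key1 : ∀ (c d : V) (q : Path c d) (x : PathAlgebra k V ⧸ I),
      G (x * pathClass I q) = x * G (pathClass I q) + G x * pathClass I q := by
    intro c d q x
    have : G.comp (LinearMap.mulRight k (pathClass I q)) =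
        LinearMap.mulRight k (G (pathClass I q)) +
          (LinearMap.mulRight k (pathClass I q)).comp G :=
      quot_hom_ext I fun a b p => key a b c d p q
    exact LinearMap.congr_fun this x
  have key2 : ∀ x y : PathAlgebra k V ⧸ I, G (x * y) = x * G y + G x * y := by
    intro x y
    have : G.comp (LinearMap.mulLeft k x) =
        (LinearMap.mulLeft k x).comp G + LinearMap.mulLeft k (G x) :=
      quot_hom_ext I fun a b p => key1 a b p x
    exact LinearMap.congr_fun this y
  refine ⟨⟨G, key2⟩, fun v => ?_, hGp⟩
  have h := key2 (idem I v) (idem I v)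
  have hv : G (idem I v) ∈ corner I v v := by rw [idem, hGp]; exact hends v v _
  rw [idem_mul_idem, idem_mul_of_mem_corner hv, mul_idem_of_mem_corner hv] at h
  exact left_eq_add.1 h

end PathAlgebra

/-! ### Normalised cocycles of a toupie algebra: diagonal action and existence. -/

namespace PathAlgebra

variable {k V : Type*} [Field k] [Quiver V] [Fintype V] [DecidableEq V]
  {I : Ideal (PathAlgebra k V)} [I.IsTwoSided] {o w : V}

/-- The coefficient of the arrow `e` in `D e`. -/
noncomputable def diagCoeff (hI : IsAdmissible I) (D : hochschildCocycle₁ k (PathAlgebra k V ⧸ I))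
    (e : QArrow V) : k :=
  acoeff hI e.2.2 (D.1 (pathClass I e.2.2.toPath))

section Normal

variable {D : hochschildCocycle₁ k (PathAlgebra k V ⧸ I)}

theorem apply_arrow (hQ : IsToupie o w) (hI : IsAdmissible I) (hD : D ∈ normalCocycles I)
    {a b : V} (e : a ⟶ b) (hab : ¬(a = o ∧ b = w)) :
    D.1 (pathClass I e.toPath) = diagCoeff hI D ⟨a, b, e⟩ • pathClass I e.toPath := by
  have := hQ.subsingleton_path hab
  obtain ⟨c, hc⟩ := exists_smul_of_mem_corner e.toPath
    (apply_mem_corner hD (pathClass_mem_corner I e.toPath))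
  rw [diagCoeff, hc, map_smul, acoeff_self, smul_eq_mul, mul_one]

/-- An arrow from source to sink cannot be prolonged, so it occurs in no path other than itself. All
arrows met here are eigenvectors, and the Leibniz rule adds their eigenvalues. -/
theorem apply_path (hQ : IsToupie o w) (hI : IsAdmissible I) (hD : D ∈ normalCocycles I)
    {a b : V} (p : Path a b) (hp : ¬(a = o ∧ b = w) ∨ p.length ≠ 1) :
    D.1 (pathClass I p) = pathWeight (diagCoeff hI D) p • pathClass I p := by
  induction p with
  | nil => rw [hD a, pathWeight_nil, zero_smul]
  | @cons c b p e ih =>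
    have hc : ¬(a = o ∧ c = w) := fun h => hQ.source_ne_of_hom e h.2
    have he : ¬(c = o ∧ b = w) := by
      rintro ⟨rfl, rfl⟩
      obtain rfl := hQ.eq_of_path_source p
      obtain rfl := hQ.path_eq_nil p
      simp at hp
    rw [pathClass_cons, hochschildCocycle₁.map_mul, ih (Or.inl hc), apply_arrow hQ hI hD e he,
      pathWeight_cons, mul_smul_comm, smul_mul_assoc, ← add_smul, add_comm]

end Normal

theorem mem_branchRelations_iff [Fintype (LongBranch I o w)] {c : LongBranch I o w →₀ k} :
    c ∈ branchRelations I o w ↔ ∑ p, c p • pathClass I p.1 = 0 := by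
  have h : mkLin I (c.sum fun p r => r • ofPath p.1) = ∑ p, c p • pathClass I p.1 := by
    rw [Finsupp.sum_fintype _ _ (by simp), map_sum]
    simp only [map_smul, mkLin_ofPath]
  rw [← h, mkLin_eq_zero]
  rfl

/-- Applying `D` to a relation between long branches, which are eigenvectors, yields another
relation. -/
theorem isDiagStable_of_mem_normalCocycles [Finite (LongBranch I o w)]
    [LinearOrder (Path o w)] (hQ : IsToupie o w)
    (hI : IsAdmissible I) {D : hochschildCocycle₁ k (PathAlgebra k V ⧸ I)}
    (hD : D ∈ normalCocycles I) :
    IsDiagStable (branchRelations I o w) fun p => pathWeight (diagCoeff hI D) p.1 := by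
  have := Fintype.ofFinite (LongBranch I o w)
  intro c hc
  refine ⟨Finsupp.equivFunOnFinite.symm fun p => pathWeight (diagCoeff hI D) p.1 * c p, ?_,
    fun _ => rfl⟩
  rw [mem_branchRelations_iff] at hc ⊢
  have h := congrArg D.1 hc
  rw [map_zero, map_sum] at h
  rw [← h]
  refine Finset.sum_congr rfl fun p _ => ?_
  rw [map_smul, apply_path hQ hI hD p.1 (Or.inr (by have := p.2.1; omega)), smul_smul, mul_comm]
  rfl

omit [I.IsTwoSided] in
theorem sum_branches {M : Type*} [AddCommMonoid M] [Fintype (Path o w)]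
    [Fintype (LongBranch I o w)] (hne : o ≠ w) (g : Path o w → M)
    (h₁ : ∀ u : o ⟶ w, g u.toPath = 0) (h₂ : ∀ p : Path o w, ofPath p ∈ I → g p = 0) :
    ∑ p, g p = ∑ p : LongBranch I o w, g p.1 := by
  classical
  rw [← Finset.sum_filter_of_ne (p := fun p : Path o w => 2 ≤ p.length ∧ ofPath p ∉ I)]
  · exact Finset.sum_subtype _ (by simp) g
  · intro p _ hp
    refine ⟨?_, fun h => hp (h₂ p h)⟩
    rcases p.eq_toPath_or_two_le_length hne with ⟨u, rfl⟩ | h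
    · exact absurd (h₁ u) hp
    · exact h

theorem exists_sum_of_mem_corner {a b : V} [Fintype (Path a b)] {x : PathAlgebra k V ⧸ I}
    (hx : x ∈ corner I a b) : ∃ f : Path a b → k, x = ∑ p, f p • pathClass I p := by
  obtain ⟨c, hc⟩ := (Submodule.mem_span_range_iff_exists_fun k).1 hx
  exact ⟨c, hc.symm⟩

theorem acoeff_sum [Fintype (Path o w)] (hI : IsAdmissible I) (f : Path o w → k) (u : o ⟶ w) :
    acoeff hI u (∑ p, f p • pathClass I p) = f u.toPath := by
  rw [map_sum, Finset.sum_eq_single u.toPath]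
  · rw [map_smul, acoeff_self, smul_eq_mul, mul_one]
  · intro p _ hp
    rw [map_smul, acoeff_of_ne, smul_zero]
    intro h
    exact hp (eq_of_heq (by simpa using h))
  · simp

/-- Elements of the corner algebra without arrow components are combinations of long branches. -/
theorem exists_sum_longBranch [Finite (Path o w)] [Fintype (LongBranch I o w)] (hne : o ≠ w)
    (hI : IsAdmissible I) {x : PathAlgebra k V ⧸ I} (hx : x ∈ corner I o w)
    (h : ∀ u : o ⟶ w, acoeff hI u x = 0) :
    ∃ f : Path o w → k, x = ∑ p : LongBranch I o w, f p.1 • pathClass I p.1 := by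
  have := Fintype.ofFinite (Path o w)
  obtain ⟨f, rfl⟩ := exists_sum_of_mem_corner hx
  have hf : ∀ u : o ⟶ w, f u.toPath = 0 := fun u => by rw [← acoeff_sum hI f u, h u]
  refine ⟨f, sum_branches hne (fun p => f p • pathClass I p) (fun u => ?_) fun p hp => ?_⟩
  · rw [hf, zero_smul]
  · rw [← mkLin_ofPath, (mkLin_eq_zero I).2 hp, smul_zero]

/-- Weights on the arrows that are compatible with the relations define a cocycle. -/
theorem exists_weightCocycle [Finite (Path o w)] [LinearOrder (Path o w)] (hQ : IsToupie o w)
    (hne : o ≠ w) (hI : IsAdmissible I) (f : QArrow V → k)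
    (hf : IsDiagStable (branchRelations I o w) fun p => pathWeight f p.1) :
    ∃ D ∈ normalCocycles I, ∀ (a b : V) (p : Path a b),
      D.1 (pathClass I p) = pathWeight f p • pathClass I p := by
  have := Fintype.ofFinite (Path o w)
  have := Fintype.ofFinite (LongBranch I o w)
  let T : PathAlgebra k V →ₗ[k] PathAlgebra k V ⧸ I :=
    Finsupp.linearCombination k fun q : QPath V => pathWeight f q.2.2 • pathClass I q.2.2
  have hT : ∀ (a b : V) (p : Path a b), T (ofPath p) = pathWeight f p • pathClass I p :=
    fun a b p => (Finsupp.linearCombination_single k _ _).trans (one_smul _ _)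
  let T' : PathAlgebra k V →ₗ[k] PathAlgebra k V :=
    Finsupp.linearCombination k fun q : QPath V => pathWeight f q.2.2 • ofPath q.2.2
  -- As `I` is two-sided it contains the corner components of its elements, so `T` need only be
  -- shown to kill these.
  have hcorner : ∀ (a b : V) (x : PathAlgebra k V), x ∈ I →
      T (ofPath (Path.nil : Path a a) * x * ofPath (Path.nil : Path b b)) = 0 := by
    intro a b x hx
    set y := ofPath (Path.nil : Path a a) * x * ofPath (Path.nil : Path b b) with hy
    have hyI : y ∈ I := I.mul_mem_right _ (I.mul_mem_left _ hx)
    have hspan : y ∈ Submodule.span k (Set.range fun p : Path a b => (ofPath p : PathAlgebra k V)) :=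
      nil_mul_mul_nil_mem_span a b x
    by_cases hab : a = o ∧ b = w
    · obtain ⟨rfl, rfl⟩ := hab
      obtain ⟨c, hc⟩ := (Submodule.mem_span_range_iff_exists_fun k).1 hspan
      have hc0 : ∑ p, c p • pathClass I p = 0 := by
        rw [← (mkLin_eq_zero I).2 hyI, ← hc, map_sum]
        simp only [map_smul, mkLin_ofPath]
      -- Arrows do not occur by admissibility and monomial branches vanish in the quotient. What is
      -- left is a relation between long branches, to which `hf` applies.
      have hcu : ∀ u : a ⟶ b, c u.toPath = 0 := fun u => by
        rw [← acoeff_sum hI c u, hc0, map_zero]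
      have hmono : ∀ p : Path a b, ofPath p ∈ I → pathClass I p = 0 := fun p hp =>
        (mkLin_eq_zero I).2 hp
      have hR : Finsupp.equivFunOnFinite.symm (fun p : LongBranch I a b => c p.1) ∈
          branchRelations I a b := by
        rw [mem_branchRelations_iff, ← hc0]
        refine (sum_branches hne (fun p => c p • pathClass I p) (fun u => ?_) fun p hp => ?_).symm
        · rw [hcu, zero_smul]
        · rw [hmono p hp, smul_zero]
      obtain ⟨c', hc'R, hc'⟩ := hf _ hR
      rw [mem_branchRelations_iff] at hc'R
      rw [← hc, map_sum, ← hc'R]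
      simp only [map_smul, hT]
      rw [sum_branches (I := I) hne]
      · refine Finset.sum_congr rfl fun p _ => ?_
        rw [hc', smul_smul, mul_comm]
        rfl
      · intro u; rw [hcu, zero_smul]
      · intro p hp; rw [hmono p hp, smul_zero, smul_zero]
    · have := hQ.subsingleton_path hab
      rcases isEmpty_or_nonempty (Path a b) with he | ⟨⟨p⟩⟩
      · rw [Set.range_eq_empty, Submodule.span_empty, Submodule.mem_bot] at hspan
        rw [hspan, map_zero]
      · have hr : Set.range (fun p : Path a b => (ofPath p : PathAlgebra k V)) = {ofPath p} := by
          have : Unique (Path a b) := uniqueOfSubsingleton p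
          rw [Set.range_unique, Subsingleton.elim p default]
        rw [hr, Submodule.mem_span_singleton] at hspan
        obtain ⟨c, hc⟩ := hspan
        rw [← hc, map_smul, hT, smul_comm, ← mkLin_ofPath, ← map_smul, hc,
          (mkLin_eq_zero I).2 hyI, smul_zero]
  have hTI : ∀ x ∈ I, T x = 0 := by
    intro x hx
    have hx1 : x = ∑ a : V, ∑ b : V,
        ofPath (Path.nil : Path a a) * x * ofPath (Path.nil : Path b b) := by
      conv_lhs => rw [← mul_one x, ← one_mul x, one_def', Finset.sum_mul, Finset.sum_mul]
      refine Finset.sum_congr rfl fun a _ => ?_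
      rw [Finset.mul_sum]
    rw [hx1, map_sum]
    refine Finset.sum_eq_zero fun a _ => ?_
    rw [map_sum]
    exact Finset.sum_eq_zero fun b _ => hcorner a b x hx
  have hends : ∀ (a b : V) (p : Path a b), T (ofPath p) ∈ corner I a b := fun a b p => by
    rw [hT]
    exact Submodule.smul_mem _ _ (pathClass_mem_corner I p)
  obtain ⟨D, hD, hDp⟩ := exists_cocycle T hTI hends fun a b c p q => by
    rw [hT, hT, hT, pathWeight_comp, mul_smul_comm, smul_mul_assoc, pathClass_mul, ← add_smul,
      add_comm]
  exact ⟨D, hD, fun a b p => (hDp a b p).trans (hT a b p)⟩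

open scoped Classical in
/-- Any values in the corner algebra on the arrows from the source to the sink define a cocycle
that vanishes on the other arrows. -/
theorem exists_arrowCocycle (hQ : IsToupie o w) (hI : IsAdmissible I)
    (φ : (o ⟶ w) → PathAlgebra k V ⧸ I) (hφ : ∀ u, φ u ∈ corner I o w) :
    ∃ D ∈ normalCocycles I, (∀ u : o ⟶ w, D.1 (pathClass I u.toPath) = φ u) ∧
      ∀ (a b : V) (p : Path a b),
        (∀ u : o ⟶ w, (⟨a, b, p⟩ : QPath V) ≠ ⟨o, w, u.toPath⟩) → D.1 (pathClass I p) = 0 := by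
  let g : QPath V → PathAlgebra k V ⧸ I := fun q =>
    if h : ∃ u : o ⟶ w, q = ⟨o, w, u.toPath⟩ then φ h.choose else 0
  have hg0 : ∀ (a b : V) (p : Path a b),
      (∀ u : o ⟶ w, (⟨a, b, p⟩ : QPath V) ≠ ⟨o, w, u.toPath⟩) → g ⟨a, b, p⟩ = 0 :=
    fun a b p h => dif_neg fun ⟨u, hu⟩ => h u hu
  have hglen : ∀ (a b : V) (p : Path a b), p.length ≠ 1 → g ⟨a, b, p⟩ = 0 := by
    refine fun a b p hp => hg0 a b p fun u h => hp ?_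
    have := congrArg (fun x : QPath V => x.2.2.length) h
    simpa using this
  have hgu : ∀ u : o ⟶ w, g ⟨o, w, u.toPath⟩ = φ u := by
    intro u
    have h : ∃ v : o ⟶ w, (⟨o, w, u.toPath⟩ : QPath V) = ⟨o, w, v.toPath⟩ := ⟨u, rfl⟩
    have h2 := h.choose_spec
    have : h.choose = u := Hom.toPath_injective (eq_of_heq (by simpa using h2.symm))
    exact (dif_pos h).trans (by rw [this])
  have hcases : ∀ (a b : V) (p : Path a b), g ⟨a, b, p⟩ = 0 ∨ (a = o ∧ b = w) := by
    intro a b p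
    by_cases h : ∃ u : o ⟶ w, (⟨a, b, p⟩ : QPath V) = ⟨o, w, u.toPath⟩
    · obtain ⟨u, hu⟩ := h
      cases hu
      exact Or.inr ⟨rfl, rfl⟩
    · exact Or.inl (dif_neg h)
  have hends : ∀ (a b : V) (p : Path a b), g ⟨a, b, p⟩ ∈ corner I a b := by
    intro a b p
    by_cases h : ∃ u : o ⟶ w, (⟨a, b, p⟩ : QPath V) = ⟨o, w, u.toPath⟩
    · obtain ⟨u, hu⟩ := h
      cases hu
      rw [hgu]
      exact hφ u
    · have : g ⟨a, b, p⟩ = 0 := dif_neg h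
      rw [this]
      exact Submodule.zero_mem _
  let T : PathAlgebra k V →ₗ[k] PathAlgebra k V ⧸ I := Finsupp.linearCombination k g
  have hT : ∀ (a b : V) (p : Path a b), T (ofPath p) = g ⟨a, b, p⟩ :=
    fun a b p => (Finsupp.linearCombination_single k _ _).trans (one_smul _ _)
  have hTI : ∀ x ∈ I, T x = 0 := by
    intro x hx
    -- `T` is supported on paths of length one, whereas `I` lies in the span of longer paths.
    refine LinearMap.mem_ker.1 (Submodule.span_le.2 ?_ (hI.2 x hx))
    rintro _ ⟨a, b, p, hp, rfl⟩
    exact LinearMap.mem_ker.2 ((hT a b p).trans (hglen a b p (by omega)))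
  have hcomp : ∀ (a b c : V) (p : Path a b) (q : Path b c),
      T (ofPath (p.comp q)) = pathClass I p * T (ofPath q) + T (ofPath p) * pathClass I q := by
    intro a b c p q
    rw [hT, hT, hT]
    cases q with
    | nil =>
      rw [hglen _ _ (Path.nil : Path b b) (by simp), mul_zero, zero_add, Path.comp_nil,
        mul_idem_of_mem_corner (hends a b p)]
    | @cons d _ q e =>
      cases p with
      | nil =>
        rw [hglen _ _ (Path.nil : Path a a) (by simp), zero_mul, add_zero, Path.nil_comp,
          idem_mul_of_mem_corner (hends _ _ _)]
      | @cons d' _ p f =>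
        rw [hglen _ _ ((p.cons f).comp (q.cons e)) (by simp)]
        -- The middle vertex has an arrow entering and an arrow leaving it, so it is neither `o` nor
        -- `w`, and neither factor runs from `o` to `w`.
        have h1 : g ⟨b, c, q.cons e⟩ = 0 := (hcases _ _ _).resolve_right fun h =>
          hQ.target_ne_source f h.1
        have h2 : g ⟨a, b, p.cons f⟩ = 0 := (hcases _ _ _).resolve_right fun h => by
          obtain ⟨m, hm⟩ := Nat.exists_eq_succ_of_ne_zero
            (show (q.cons e).length ≠ 0 by simp)
          obtain ⟨_, e', _⟩ := Path.eq_toPath_comp_of_length_eq_succ _ hm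
          exact hQ.source_ne_of_hom e' h.2
        rw [h1, h2, mul_zero, zero_mul, add_zero]
  obtain ⟨D, hD, hDp⟩ := exists_cocycle T hTI (fun a b p => by rw [hT]; exact hends a b p) hcomp
  exact ⟨D, hD, fun u => by rw [hDp, hT, hgu], fun a b p hp => by rw [hDp, hT, hg0 a b p hp]⟩

end PathAlgebra

/-! ### First arrows, and the cocycles `y`, `t` and `z`. -/

namespace PathAlgebra

section FirstArrow

variable {k V : Type*} [Field k] [Quiver V] {o w : V}

theorem pathWeight_eq_zero_of_ne_source (hQ : IsToupie o w) {f : QArrow V → k}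
    (hf : ∀ e : QArrow V, e.1 ≠ o → f e = 0) {a b : V} (ha : a ≠ o) (p : Path a b) :
    pathWeight f p = 0 := by
  induction p with
  | nil => rfl
  | @cons c b p e ih =>
    have hc : c ≠ o := by
      rintro rfl
      exact ha (hQ.eq_of_path_source p)
    rw [pathWeight_cons, ih, hf ⟨c, b, e⟩ hc, add_zero]

/-- The first arrow is the only arrow of a branch that leaves the source. -/
theorem pathWeight_branch (hQ : IsToupie o w) {f : QArrow V → k}
    (hf : ∀ e : QArrow V, e.1 ≠ o → f e = 0) {p : Path o w} {e : QArrow V}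
    (he : IsFirstArrow e p) : pathWeight f p = f e := by
  obtain ⟨u, g, q, rfl, rfl⟩ := he
  rw [pathWeight_comp, pathWeight_toPath,
    pathWeight_eq_zero_of_ne_source hQ hf (hQ.target_ne_source g), add_zero]

theorem exists_isFirstArrow (hne : o ≠ w) (p : Path o w) :
    ∃ e : QArrow V, IsFirstArrow e p := by
  obtain ⟨u, f, q, rfl⟩ := p.exists_first hne
  exact ⟨⟨o, u, f⟩, u, f, q, rfl, rfl⟩

theorem isFirstArrow_toPath (u : o ⟶ w) : IsFirstArrow ⟨o, w, u⟩ u.toPath :=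
  ⟨w, u, Path.nil, rfl, (Path.comp_nil _).symm⟩

theorem exists_branch_of_source [Finite V] (hQ : IsToupie o w) {u : V} (f : o ⟶ u) :
    ∃ p : Path o w, IsFirstArrow ⟨o, u, f⟩ p := by
  obtain ⟨q⟩ := hQ.exists_path_sink u
  exact ⟨_, u, f, q, rfl, rfl⟩

/-- The first arrow of a branch of length at least two does not end at the sink. -/
theorem ne_of_isFirstArrow (hQ : IsToupie o w) {p : Path o w} (hp : 2 ≤ p.length) {e : QArrow V}
    (he : IsFirstArrow e p) : ¬(e.1 = o ∧ e.2.1 = w) := by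
  obtain ⟨u, f, q, rfl, rfl⟩ := he
  rintro ⟨-, h⟩
  change u = w at h
  subst h
  obtain rfl := hQ.path_eq_nil q
  simp at hp

open scoped Classical in
/-- The weight on arrows that is `d p` on the first arrow of each branch `p`. -/
noncomputable def firstWeight (d : Path o w → k) (e : QArrow V) : k :=
  if h : ∃ p : Path o w, IsFirstArrow e p then d h.choose else 0

theorem firstWeight_eq (hQ : IsToupie o w) (d : Path o w → k) {e : QArrow V} {p : Path o w}
    (he : IsFirstArrow e p) : firstWeight d e = d p := by
  have h : ∃ p : Path o w, IsFirstArrow e p := ⟨p, he⟩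
  rw [firstWeight, dif_pos h, hQ.isFirstArrow_unique h.choose_spec he]

theorem firstWeight_eq_zero (d : Path o w → k) {e : QArrow V}
    (he : ∀ p : Path o w, IsFirstArrow e p → d p = 0) : firstWeight d e = 0 := by
  by_cases h : ∃ p : Path o w, IsFirstArrow e p
  · rw [firstWeight, dif_pos h]
    exact he _ h.choose_spec
  · rw [firstWeight, dif_neg h]

theorem IsFirstArrow.source_eq {e : QArrow V} {p : Path o w} (he : IsFirstArrow e p) :
    e.1 = o := by
  obtain ⟨u, f, q, rfl, rfl⟩ := he
  rfl

theorem firstWeight_eq_zero_of_ne (d : Path o w → k) {e : QArrow V} (he : e.1 ≠ o) :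
    firstWeight d e = 0 :=
  firstWeight_eq_zero d fun _ hp => absurd (IsFirstArrow.source_eq hp) he

theorem pathWeight_firstWeight (hQ : IsToupie o w) (hne : o ≠ w) (d : Path o w → k)
    (p : Path o w) : pathWeight (firstWeight d) p = d p := by
  obtain ⟨e, he⟩ := exists_isFirstArrow hne p
  rw [pathWeight_branch hQ (fun e he => firstWeight_eq_zero_of_ne d he) he,
    firstWeight_eq hQ d he]

end FirstArrow

variable {k V : Type*} [Field k] [Quiver V] [Fintype V] [DecidableEq V]
  {I : Ideal (PathAlgebra k V)} [I.IsTwoSided] {o w : V}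

/-- The class of an arrow. -/
noncomputable abbrev arrowClass (I : Ideal (PathAlgebra k V)) [I.IsTwoSided] (e : QArrow V) :
    PathAlgebra k V ⧸ I := pathClass I e.2.2.toPath

theorem exists_branchCocycle [Finite (Path o w)] [LinearOrder (Path o w)] (hQ : IsToupie o w)
    (hne : o ≠ w) (hI : IsAdmissible I) (d : Path o w → k)
    (hd : IsDiagStable (branchRelations I o w) fun p => d p.1) :
    ∃ D ∈ normalCocycles I, ∀ e : QArrow V,
      D.1 (arrowClass I e) = firstWeight d e • arrowClass I e := by
  obtain ⟨D, hD, h⟩ := exists_weightCocycle hQ hne hI (firstWeight d) (by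
    simpa only [pathWeight_firstWeight hQ hne] using hd)
  exact ⟨D, hD, fun e => by rw [h, pathWeight_toPath]⟩

omit [I.IsTwoSided] in
theorem two_le_length_of_mem (hI : IsAdmissible I) {p : Path o w}
    (hp : ofPath p ∈ I) : 2 ≤ p.length := by
  by_contra h
  have := pathCoeff_eq_zero hI (not_le.1 h) hp
  rw [pathCoeff_ofPath_self] at this
  exact one_ne_zero this

theorem pathClass_eq_zero {a b : V} {p : Path a b} : pathClass I p = 0 ↔ ofPath p ∈ I :=
  mkLin_eq_zero I

/-! #### The cocycles attached to branches -/

theorem exists_yCocycle [Finite (Path o w)] [LinearOrder (Path o w)] (hQ : IsToupie o w)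
    (hne : o ≠ w) (hI : IsAdmissible I) (p : MonomialBranch I o w) :
    ∃ D ∈ normalCocycles I, ∀ e : QArrow V,
      D.1 (arrowClass I e) = firstWeight (Set.indicator {p.1} 1 : Path o w → k) e • arrowClass I e := by
  -- A monomial branch is not one of the long branches, so its indicator acts as zero on the
  -- relations.
  refine exists_branchCocycle hQ hne hI _ fun c _ => ⟨0, Submodule.zero_mem _, fun i => ?_⟩
  have : i.1 ≠ p.1 := fun h => i.2.2 (h ▸ p.2)
  simp [this]

theorem yCochain_eq [LinearOrder (Path o w)] (hQ : IsToupie o w) (p : Path o w) (e : QArrow V) :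
    yCochain I p e = firstWeight (Set.indicator {p} 1 : Path o w → k) e • arrowClass I e := by
  rw [yCochain]
  split_ifs with h
  · rw [firstWeight_eq hQ _ h, Set.indicator_of_mem (Set.mem_singleton _), Pi.one_apply, one_smul]
  · rw [firstWeight_eq_zero, zero_smul]
    intro q hq
    refine Set.indicator_of_notMem ?_ _
    rintro rfl
    exact h hq

open scoped Classical in
/-- The indicator function of a connected component of the graph of branches. -/
noncomputable def componentIndicator [LinearOrder (Path o w)]
    (c : (branchGraph I o w).ConnectedComponent) (p : Path o w) : k :=
  if ∃ q : c.supp, q.1.1 = p then 1 else 0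

omit [I.IsTwoSided] in
theorem componentIndicator_long [LinearOrder (Path o w)]
    (c : (branchGraph I o w).ConnectedComponent) [DecidableEq (branchGraph I o w).ConnectedComponent]
    (p : LongBranch I o w) :
    componentIndicator c p.1 =
      if (branchGraph I o w).connectedComponentMk p = c then (1 : k) else 0 := by
  classical
  rw [componentIndicator]
  refine if_congr ⟨?_, ?_⟩ rfl rfl
  · rintro ⟨⟨q, hq⟩, hqp⟩
    rw [← Subtype.ext hqp]
    exact hq
  · intro h
    exact ⟨⟨p, h⟩, rfl⟩

omit [I.IsTwoSided] in
theorem componentIndicator_of_not [LinearOrder (Path o w)]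
    (c : (branchGraph I o w).ConnectedComponent) {p : Path o w}
    (hp : ¬(2 ≤ p.length ∧ ofPath p ∉ I)) : (componentIndicator c p : k) = 0 :=
  if_neg fun ⟨q, hq⟩ => hp (hq ▸ q.1.2)

omit [I.IsTwoSided] in
theorem connectedComponentMk_eq_of_row [LinearOrder (Path o w)] {ρ : LongBranch I o w →₀ k}
    (hρ : IsReducedRow (branchRelations I o w) ρ) {i j : LongBranch I o w} (hi : ρ i ≠ 0)
    (hj : ρ j ≠ 0) :
    (branchGraph I o w).connectedComponentMk i = (branchGraph I o w).connectedComponentMk j := by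
  by_cases hij : i = j
  · rw [hij]
  · have : (branchGraph I o w).Adj i j := ⟨hij, ρ, hρ, hi, hj⟩
    exact SimpleGraph.ConnectedComponent.sound this.reachable

/-- The branches occurring in one reduced row are pairwise adjacent, so the indicator of a component
is constant on each row. -/
theorem exists_tCocycle [Finite (Path o w)] [LinearOrder (Path o w)] (hQ : IsToupie o w)
    (hne : o ≠ w) (hI : IsAdmissible I) (c : (branchGraph I o w).ConnectedComponent) :
    ∃ D ∈ normalCocycles I, ∀ e : QArrow V,
      D.1 (arrowClass I e) = firstWeight (componentIndicator c) e • arrowClass I e := by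
  classical
  refine exists_branchCocycle hQ hne hI _ (isDiagStable_of_rows fun ρ hρ i j hi hj => ?_)
  rw [componentIndicator_long, componentIndicator_long, connectedComponentMk_eq_of_row hρ hi hj]

/-- A given arrow starts at most one branch, so the sum over the component has at most one nonzero
term. -/
theorem tCochain_eq [LinearOrder (Path o w)] (hQ : IsToupie o w)
    (c : (branchGraph I o w).ConnectedComponent) (e : QArrow V) :
    tCochain I c e = firstWeight (componentIndicator c) e • arrowClass I e := by
  rw [tCochain]
  by_cases h : ∃ q : c.supp, IsFirstArrow e q.1.1
  · obtain ⟨q, hq⟩ := h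
    rw [finsum_eq_single _ q, yCochain, if_pos hq, firstWeight_eq hQ _ hq, componentIndicator,
      if_pos ⟨q, rfl⟩, one_smul]
    intro q' hq'
    rw [yCochain, if_neg]
    intro h
    exact hq' (Subtype.ext (Subtype.ext (hQ.isFirstArrow_unique h hq)))
  · push Not at h
    rw [firstWeight_eq_zero, zero_smul, ← finsum_zero (α := c.supp)]
    · exact finsum_congr fun q => if_neg (h q)
    · intro p hp
      exact if_neg fun ⟨q, hq⟩ => h q (hq ▸ hp)

theorem exists_zCocycle (hQ : IsToupie o w) (hI : IsAdmissible I) (u : o ⟶ w) (p : Path o w) :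
    ∃ D ∈ normalCocycles I, ∀ e : QArrow V, D.1 (arrowClass I e) = zCochain I u p e := by
  classical
  obtain ⟨D, hD, h1, h2⟩ := exists_arrowCocycle hQ hI
    (fun v => if v = u then pathClass I p else 0) fun v => by
      split_ifs
      · exact pathClass_mem_corner I p
      · exact Submodule.zero_mem _
  refine ⟨D, hD, fun ⟨a, b, e⟩ => ?_⟩
  rw [zCochain]
  by_cases h : ∃ v : o ⟶ w, (⟨a, b, e⟩ : QArrow V) = ⟨o, w, v⟩
  · obtain ⟨v, hv⟩ := h
    cases hv
    refine (h1 v).trans (if_congr ⟨fun h => h ▸ rfl, fun h => ?_⟩ rfl rfl)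
    exact eq_of_heq (by simpa using h)
  · rw [if_neg fun h' => h ⟨u, h'⟩]
    refine h2 a b e.toPath fun v hv => h ⟨v, ?_⟩
    have ha : a = o := congrArg (fun x : QPath V => x.1) hv
    have hb : b = w := congrArg (fun x : QPath V => x.2.1) hv
    subst ha hb
    have hev : e = v := Hom.toPath_injective (eq_of_heq (by simpa using hv))
    rw [hev]

end PathAlgebra

/-! ### The subspaces of cocycles behind the two ideals, and their brackets. -/

namespace PathAlgebra

variable {k V : Type*} [Field k] [Quiver V] [Fintype V] [DecidableEq V]
  {I : Ideal (PathAlgebra k V)} [I.IsTwoSided] {o w : V}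

variable (I) in
/-- The normalized cocycles that vanish on the arrows in `S`. -/
noncomputable def vanishingCocycles (S : Set (QArrow V)) :
    Submodule k (hochschildCocycle₁ k (PathAlgebra k V ⧸ I)) where
  carrier := {D | D ∈ normalCocycles I ∧ ∀ e ∈ S, D.1 (arrowClass I e) = 0}
  add_mem' {D E} hD hE := ⟨Submodule.add_mem _ hD.1 hE.1, fun e he => by
    change D.1 _ + E.1 _ = 0
    rw [hD.2 e he, hE.2 e he, add_zero]⟩
  zero_mem' := ⟨Submodule.zero_mem _, fun _ _ => rfl⟩
  smul_mem' c D hD := ⟨Submodule.smul_mem _ c hD.1, fun e he => by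
    change c • D.1 _ = 0
    rw [hD.2 e he, smul_zero]⟩

variable (o w) in
/-- The cocycles for which the images of the arrows from the source to the sink have no components
along such arrows. -/
noncomputable def nonlinearCocycles (hI : IsAdmissible I) :
    Submodule k (hochschildCocycle₁ k (PathAlgebra k V ⧸ I)) where
  carrier := {D | ∀ u v : o ⟶ w, acoeff hI v (D.1 (pathClass I u.toPath)) = 0}
  add_mem' {D E} hD hE u v := by
    change acoeff hI v (D.1 _ + E.1 _) = 0
    rw [map_add, hD u v, hE u v, add_zero]
  zero_mem' u v := map_zero _
  smul_mem' c D hD u v := by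
    change acoeff hI v (c • D.1 _) = 0
    rw [map_smul, hD u v, smul_zero]

theorem acoeff_of_two_le (hI : IsAdmissible I) {a b c d : V} (e : a ⟶ b) {p : Path c d}
    (hp : 2 ≤ p.length) : acoeff hI e (pathClass I p) = 0 := by
  refine acoeff_of_ne hI fun h => ?_
  have := congrArg (fun x : QPath V => x.2.2.length) h
  simp only [Path.length_toPath] at this
  omega

section Bracket

variable {D E : hochschildCocycle₁ k (PathAlgebra k V ⧸ I)}

theorem apply_branch (hQ : IsToupie o w) (hI : IsAdmissible I) (hD : D ∈ normalCocycles I)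
    {p : Path o w} (hp : 2 ≤ p.length) :
    D.1 (pathClass I p) = pathWeight (diagCoeff hI D) p • pathClass I p :=
  apply_path hQ hI hD p (Or.inr (by omega))

/-- Long branches go to multiples of themselves and have no arrow component, so modulo them `D` acts
by its matrix on the arrows. -/
theorem acoeff_apply [Fintype (o ⟶ w)] (hQ : IsToupie o w) (hne : o ≠ w) (hI : IsAdmissible I)
    (hD : D ∈ normalCocycles I) (v : o ⟶ w) {x : PathAlgebra k V ⧸ I} (hx : x ∈ corner I o w) :
    acoeff hI v (D.1 x) =
      ∑ u : o ⟶ w, acoeff hI u x * acoeff hI v (D.1 (pathClass I u.toPath)) := by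
  induction hx using Submodule.span_induction with
  | mem x h =>
    obtain ⟨p, rfl⟩ := h
    rcases p.eq_toPath_or_two_le_length hne with ⟨u, rfl⟩ | h
    · rw [Finset.sum_eq_single u]
      · rw [acoeff_self, one_mul]
      · intro u' _ hu'
        rw [acoeff_of_ne, zero_mul]
        intro h
        exact hu' (Hom.toPath_injective (eq_of_heq (by simpa using h.symm)))
      · simp
    · dsimp only
      rw [apply_branch hQ hI hD h, map_smul, acoeff_of_two_le hI v h, smul_zero]
      exact (Finset.sum_eq_zero fun u _ => by rw [acoeff_of_two_le hI u h, zero_mul]).symm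
  | zero => simp
  | add x y _ _ hx hy =>
    rw [map_add, map_add, hx, hy, ← Finset.sum_add_distrib]
    simp only [map_add, add_mul]
  | smul c x _ hx =>
    rw [map_smul, map_smul, hx, Finset.smul_sum]
    simp only [map_smul, smul_eq_mul, mul_assoc]

theorem lie_apply_arrow (hQ : IsToupie o w) (hI : IsAdmissible I) (hD : D ∈ normalCocycles I)
    (hE : E ∈ normalCocycles I) {e : QArrow V} (he : ¬(e.1 = o ∧ e.2.1 = w)) :
    (⁅D, E⁆ : hochschildCocycle₁ k (PathAlgebra k V ⧸ I)).1 (arrowClass I e) = 0 := by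
  rw [lie_apply, apply_arrow hQ hI hD e.2.2 he, apply_arrow hQ hI hE e.2.2 he, map_smul, map_smul,
    apply_arrow hQ hI hD e.2.2 he, apply_arrow hQ hI hE e.2.2 he, smul_comm, sub_self]

variable (I o w) in
/-- The cocycles spanned by the cochains `u ∥ β`, with `β` of length at least two. -/
noncomputable def arrowCocycles (hI : IsAdmissible I) :
    Submodule k (hochschildCocycle₁ k (PathAlgebra k V ⧸ I)) :=
  vanishingCocycles I {e | ¬(e.1 = o ∧ e.2.1 = w)} ⊓ nonlinearCocycles o w hI

variable (I o w) in
/-- The cocycles spanned by those of the form `t` and `z`. -/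
noncomputable def linearCocycles (hI : IsAdmissible I) :
    Submodule k (hochschildCocycle₁ k (PathAlgebra k V ⧸ I)) :=
  vanishingCocycles I {e | e.1 ≠ o ∨ ∃ p : MonomialBranch I o w, IsFirstArrow e p.1} ⊓
    nonlinearCocycles o w hI

variable (I o w) in
/-- The cocycles spanned by those of the form `y`. -/
noncomputable def monomialCocycles : Submodule k (hochschildCocycle₁ k (PathAlgebra k V ⧸ I)) :=
  vanishingCocycles I {e | ¬∃ p : MonomialBranch I o w, IsFirstArrow e p.1}

theorem arrowCocycles_le (hQ : IsToupie o w) (hI : IsAdmissible I) :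
    arrowCocycles I o w hI ≤ linearCocycles I o w hI := by
  rintro D ⟨⟨hD, hS⟩, hn⟩
  refine ⟨⟨hD, fun e he => hS e ?_⟩, hn⟩
  rcases he with he | ⟨p, hp⟩
  · exact fun h => he h.1
  · exact ne_of_isFirstArrow hQ (two_le_length_of_mem hI p.2) hp

/-- Diagonal actions on the other arrows commute, and the zero matrix of `E` makes the matrix of the
commutator zero. This gives both that `L` is an ideal and that its derived algebra lies in the span
of the `z`. -/
theorem lie_mem_arrowCocycles [Finite (o ⟶ w)] (hQ : IsToupie o w) (hne : o ≠ w)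
    (hI : IsAdmissible I) (hD : D ∈ normalCocycles I) (hE : E ∈ normalCocycles I)
    (hE' : E ∈ nonlinearCocycles o w hI) : ⁅D, E⁆ ∈ arrowCocycles I o w hI := by
  have := Fintype.ofFinite (o ⟶ w)
  refine ⟨⟨lie_mem_normalCocycles hD hE, fun e he => lie_apply_arrow hQ hI hD hE he⟩,
    fun u v => ?_⟩
  have hu := pathClass_mem_corner I u.toPath
  rw [lie_apply, map_sub, acoeff_apply hQ hne hI hD v (apply_mem_corner hE hu),
    acoeff_apply hQ hne hI hE v (apply_mem_corner hD hu), Finset.sum_eq_zero, Finset.sum_eq_zero,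
    sub_zero]
  · exact fun x _ => by rw [hE' x v, mul_zero]
  · exact fun x _ => by rw [hE' u x, zero_mul]

theorem apply_branch_eq_zero (hQ : IsToupie o w) (hI : IsAdmissible I)
    {S : Set (QArrow V)} (hD : D ∈ vanishingCocycles I S) (hS : ∀ e : QArrow V, e.1 ≠ o → e ∈ S)
    {p : Path o w} (hp : 2 ≤ p.length) {e : QArrow V} (he : IsFirstArrow e p) (heS : e ∈ S) :
    D.1 (pathClass I p) = 0 := by
  have hd : ∀ e ∈ S, diagCoeff hI D e = 0 := fun e he => by
    rw [diagCoeff]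
    exact (congrArg (acoeff hI e.2.2) (hD.2 e he)).trans (map_zero _)
  rw [apply_branch hQ hI hD.1 hp, pathWeight_branch hQ (fun e he => hd e (hS e he)) he, hd e heS,
    zero_smul]

/-- Each of the two cocycles sends arrows of `Z` to combinations of long branches, which the other
kills. Both composites therefore vanish on `Z`. -/
theorem lie_arrowCocycles [Finite (Path o w)] (hQ : IsToupie o w) (hne : o ≠ w)
    (hI : IsAdmissible I) (hD : D ∈ arrowCocycles I o w hI) (hE : E ∈ arrowCocycles I o w hI) :
    ⁅D, E⁆ = 0 := by
  have := Fintype.ofFinite (LongBranch I o w)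
  have key : ∀ D ∈ arrowCocycles I o w hI, ∀ E ∈ arrowCocycles I o w hI, ∀ u : o ⟶ w,
      D.1 (E.1 (pathClass I u.toPath)) = 0 := by
    intro D hD E hE u
    obtain ⟨f, hf⟩ := exists_sum_longBranch hne hI
      (apply_mem_corner hE.1.1 (pathClass_mem_corner I u.toPath)) (hE.2 u)
    rw [hf, map_sum]
    refine Finset.sum_eq_zero fun p _ => ?_
    obtain ⟨e, he⟩ := exists_isFirstArrow hne p.1
    rw [map_smul, apply_branch_eq_zero hQ hI hD.1 (fun e he h => he h.1) p.2.1 he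
      (ne_of_isFirstArrow hQ p.2.1 he), smul_zero]
  refine normalCocycles_ext (lie_mem_normalCocycles hD.1.1 hE.1.1) (Submodule.zero_mem _) ?_
  intro a b e
  by_cases hab : a = o ∧ b = w
  · obtain ⟨rfl, rfl⟩ := hab
    rw [lie_apply, key D hD E hE, key E hE D hD, sub_zero]
    rfl
  · exact lie_apply_arrow hQ hI hD.1.1 hE.1.1 (e := ⟨a, b, e⟩) hab

/-- `E` kills the whole corner from `o` to `w`: it is supported on first arrows of branches that are
already zero in the quotient. Passing to classes, the `y` are central. -/
theorem lie_monomialCocycles [Finite (Path o w)] (hQ : IsToupie o w) (hne : o ≠ w)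
    (hI : IsAdmissible I) (hD : D ∈ normalCocycles I) (hE : E ∈ monomialCocycles I o w) :
    ⁅D, E⁆ = 0 := by
  have := Fintype.ofFinite (Path o w)
  have hS : ∀ e : QArrow V, e.1 ≠ o → ¬∃ p : MonomialBranch I o w, IsFirstArrow e p.1 :=
    fun e he ⟨p, hp⟩ => he (IsFirstArrow.source_eq hp)
  have hu : ∀ u : o ⟶ w, E.1 (pathClass I u.toPath) = 0 := fun u => hE.2 ⟨o, w, u⟩
    fun ⟨p, hp⟩ => ne_of_isFirstArrow hQ (two_le_length_of_mem hI p.2) hp ⟨rfl, rfl⟩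
  have hcorner : ∀ x ∈ corner I o w, E.1 x = 0 := by
    intro x hx
    obtain ⟨f, rfl⟩ := exists_sum_of_mem_corner hx
    rw [map_sum]
    refine Finset.sum_eq_zero fun p _ => ?_
    rw [map_smul]
    rcases p.eq_toPath_or_two_le_length hne with ⟨u, rfl⟩ | h
    · rw [hu, smul_zero]
    · by_cases hp : ofPath p ∈ I
      · rw [pathClass_eq_zero.2 hp, map_zero, smul_zero]
      · obtain ⟨e, he⟩ := exists_isFirstArrow hne p
        rw [apply_branch_eq_zero hQ hI hE hS h he, smul_zero]
        rintro ⟨q, hq⟩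
        exact hp (hQ.isFirstArrow_unique he hq ▸ q.2)
  refine normalCocycles_ext (lie_mem_normalCocycles hD hE.1) (Submodule.zero_mem _) ?_
  intro a b e
  by_cases hab : a = o ∧ b = w
  · obtain ⟨rfl, rfl⟩ := hab
    rw [lie_apply, hu, map_zero, hcorner _ (apply_mem_corner hD (pathClass_mem_corner I _)),
      sub_zero]
    rfl
  · exact lie_apply_arrow hQ hI hD hE.1 (e := ⟨a, b, e⟩) hab

theorem monomialCocycles_le (hQ : IsToupie o w) (hI : IsAdmissible I) :
    monomialCocycles I o w ≤ nonlinearCocycles o w hI := by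
  intro D hD u v
  have : D.1 (pathClass I u.toPath) = 0 := hD.2 ⟨o, w, u⟩
    fun ⟨p, hp⟩ => ne_of_isFirstArrow hQ (two_le_length_of_mem hI p.2) hp ⟨rfl, rfl⟩
  rw [this, map_zero]

end Bracket

/-! #### Spanning sets -/

theorem sum_apply {ι : Type*} (s : Finset ι)
    (D : ι → hochschildCocycle₁ k (PathAlgebra k V ⧸ I)) (x : PathAlgebra k V ⧸ I) :
    (∑ i ∈ s, D i).1 x = ∑ i ∈ s, (D i).1 x := by
  classical
  induction s using Finset.induction_on with
  | empty => rfl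
  | insert a s ha ih => rw [Finset.sum_insert ha, Finset.sum_insert ha, ← ih]; rfl

theorem cocycle_ext_of_arrows {D E : hochschildCocycle₁ k (PathAlgebra k V ⧸ I)}
    (hD : D ∈ normalCocycles I) (hE : E ∈ normalCocycles I)
    (h : ∀ e : QArrow V, D.1 (arrowClass I e) = E.1 (arrowClass I e)) : D = E :=
  normalCocycles_ext hD hE fun a b e => h ⟨a, b, e⟩

theorem smul_apply (c : k) (D : hochschildCocycle₁ k (PathAlgebra k V ⧸ I))
    (x : PathAlgebra k V ⧸ I) : (c • D).1 x = c • D.1 x := rfl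

theorem sub_apply (D E : hochschildCocycle₁ k (PathAlgebra k V ⧸ I)) (x : PathAlgebra k V ⧸ I) :
    (D - E).1 x = D.1 x - E.1 x := rfl

variable [Finite (Path o w)] [LinearOrder (Path o w)]

omit [LinearOrder (Path o w)] in
theorem monomialCocycles_eq_span (hQ : IsToupie o w) (hI : IsAdmissible I)
    {y : MonomialBranch I o w → hochschildCocycle₁ k (PathAlgebra k V ⧸ I)}
    (hy : ∀ p, y p ∈ normalCocycles I ∧ ∀ e : QArrow V, (y p).1 (arrowClass I e) =
      firstWeight (Set.indicator {p.1} 1 : Path o w → k) e • arrowClass I e) :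
    monomialCocycles I o w = Submodule.span k (Set.range y) := by
  classical
  have := Fintype.ofFinite (MonomialBranch I o w)
  have hvan : ∀ p (e : QArrow V), (¬∃ p : MonomialBranch I o w, IsFirstArrow e p.1) →
      (y p).1 (arrowClass I e) = 0 := by
    intro p e he
    rw [(hy p).2, firstWeight_eq_zero, zero_smul]
    intro q hq
    refine Set.indicator_of_notMem ?_ _
    rintro rfl
    exact he ⟨p, hq⟩
  apply le_antisymm
  · intro D hD
    -- The weight along `p` reduces to the coefficient of its first arrow, since `D` kills all
    -- arrows not leaving `o`.
    have : D = ∑ p, pathWeight (diagCoeff hI D) p.1 • y p := by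
      refine cocycle_ext_of_arrows hD.1
        (Submodule.sum_mem _ fun p _ => Submodule.smul_mem _ _ (hy p).1) fun e => ?_
      simp only [sum_apply, smul_apply]
      by_cases he : ∃ p : MonomialBranch I o w, IsFirstArrow e p.1
      · obtain ⟨p, hp⟩ := he
        have hdz : ∀ e : QArrow V, e.1 ≠ o → diagCoeff hI D e = 0 := fun e he => by
          rw [diagCoeff]
          exact (congrArg (acoeff hI e.2.2) (hD.2 e fun ⟨q, hq⟩ =>
            he (IsFirstArrow.source_eq hq))).trans (map_zero _)
        rw [Finset.sum_eq_single p]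
        · rw [(hy p).2, firstWeight_eq hQ _ hp, Set.indicator_of_mem (Set.mem_singleton _), Pi.one_apply, one_smul,
            pathWeight_branch hQ hdz hp]
          exact apply_arrow hQ hI hD.1 e.2.2
            (ne_of_isFirstArrow hQ (two_le_length_of_mem hI p.2) hp)
        · intro q _ hq
          rw [(hy q).2, firstWeight_eq hQ _ hp, Set.indicator_of_notMem, zero_smul, smul_zero]
          exact fun h => hq (Subtype.ext h.symm)
        · simp
      · rw [hD.2 e he]
        exact (Finset.sum_eq_zero fun p _ => by rw [hvan p e he, smul_zero]).symm
    rw [this]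
    exact Submodule.sum_mem _ fun p _ => Submodule.smul_mem _ _ (Submodule.subset_span ⟨p, rfl⟩)
  · rw [Submodule.span_le]
    rintro _ ⟨p, rfl⟩
    exact ⟨(hy p).1, fun e he => hvan p e he⟩

/-- The reduced row with pivot `p` rewrites `p` in terms of non-pivot branches. -/
theorem pathClass_mem_span_irreducible (p : LongBranch I o w) :
    pathClass I p.1 ∈ Submodule.span k
      (Set.range fun s : IrreducibleLongBranch I o w => pathClass I s.1.1) := by
  have := Fintype.ofFinite (LongBranch I o w)
  set S := Submodule.span k
    (Set.range fun s : IrreducibleLongBranch I o w => pathClass I s.1.1) with hS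
  by_cases hp : IsPivot (branchRelations I o w) p
  · obtain ⟨ρ, hρ, hρp, -, hρ0⟩ := exists_isReducedRow _ p hp
    rw [mem_branchRelations_iff, ← Finset.add_sum_erase _ _ (Finset.mem_univ p), hρp,
      one_smul] at hρ
    rw [eq_neg_of_add_eq_zero_left hρ]
    refine S.neg_mem (S.sum_mem fun q hq => ?_)
    by_cases hqp : IsPivot (branchRelations I o w) q
    · rw [hρ0 q (Finset.ne_of_mem_erase hq) hqp, zero_smul]
      exact S.zero_mem
    · exact S.smul_mem _ (Submodule.subset_span ⟨⟨q, hqp⟩, rfl⟩)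
  · exact Submodule.subset_span ⟨⟨p, hp⟩, rfl⟩

omit [Finite (Path o w)] [LinearOrder (Path o w)] in
theorem zCochain_arrow (u v : o ⟶ w) [Decidable (v = u)] (p : Path o w) :
    zCochain I u p ⟨o, w, v⟩ = if v = u then pathClass I p else 0 := by
  classical
  rw [zCochain]
  exact if_congr ⟨fun h => eq_of_heq (by simpa using h), fun h => h ▸ rfl⟩ rfl rfl

theorem arrowCocycles_eq_span [Finite (o ⟶ w)] (hne : o ≠ w) (hI : IsAdmissible I)
    {z : (o ⟶ w) → IrreducibleLongBranch I o w → hochschildCocycle₁ k (PathAlgebra k V ⧸ I)}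
    (hz : ∀ u s, z u s ∈ normalCocycles I ∧ ∀ e : QArrow V, (z u s).1 (arrowClass I e) =
      zCochain I u s.1.1 e) :
    arrowCocycles I o w hI = Submodule.span k
      (Set.range fun us : (o ⟶ w) × IrreducibleLongBranch I o w => z us.1 us.2) := by
  classical
  have := Fintype.ofFinite (o ⟶ w)
  have := Fintype.ofFinite (LongBranch I o w)
  have := Fintype.ofFinite (IrreducibleLongBranch I o w)
  have hvan : ∀ u s (e : QArrow V), ¬(e.1 = o ∧ e.2.1 = w) → (z u s).1 (arrowClass I e) = 0 := by
    intro u s e he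
    rw [(hz u s).2, zCochain, if_neg]
    rintro rfl
    exact he ⟨rfl, rfl⟩
  have hval : ∀ u s (v : o ⟶ w), (z u s).1 (pathClass I v.toPath) =
      if v = u then pathClass I s.1.1 else 0 := fun u s v =>
    ((hz u s).2 ⟨o, w, v⟩).trans (zCochain_arrow u v s.1.1)
  apply le_antisymm
  · rintro D ⟨⟨hD, hS⟩, hn⟩
    have hmem : ∀ u : o ⟶ w, ∃ g : IrreducibleLongBranch I o w → k,
        D.1 (pathClass I u.toPath) = ∑ s, g s • pathClass I s.1.1 := by
      intro u
      obtain ⟨f, hf⟩ := exists_sum_longBranch hne hI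
        (apply_mem_corner hD (pathClass_mem_corner I u.toPath)) (hn u)
      have : D.1 (pathClass I u.toPath) ∈ Submodule.span k
          (Set.range fun s : IrreducibleLongBranch I o w => pathClass I s.1.1) := by
        rw [hf]
        exact Submodule.sum_mem _ fun p _ =>
          Submodule.smul_mem _ _ (pathClass_mem_span_irreducible p)
      obtain ⟨g, hg⟩ := (Submodule.mem_span_range_iff_exists_fun k).1 this
      exact ⟨g, hg.symm⟩
    choose g hg using hmem
    have : D = ∑ u, ∑ s, g u s • z u s := by
      refine cocycle_ext_of_arrows hD (Submodule.sum_mem _ fun u _ =>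
        Submodule.sum_mem _ fun s _ => Submodule.smul_mem _ _ (hz u s).1) fun e => ?_
      simp only [sum_apply, smul_apply]
      by_cases he : e.1 = o ∧ e.2.1 = w
      · obtain ⟨a, b, e⟩ := e
        obtain ⟨rfl, rfl⟩ := he
        rw [Finset.sum_eq_single e]
        · refine (hg e).trans (Finset.sum_congr rfl fun s _ => ?_)
          rw [hval, if_pos rfl]
        · intro u _ hu
          refine Finset.sum_eq_zero fun s _ => ?_
          rw [hval, if_neg hu.symm, smul_zero]
        · simp
      · rw [hS e he]
        refine (Finset.sum_eq_zero fun u _ => Finset.sum_eq_zero fun s _ => ?_).symm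
        rw [hvan u s e he, smul_zero]
    rw [this]
    exact Submodule.sum_mem _ fun u _ => Submodule.sum_mem _ fun s _ =>
      Submodule.smul_mem _ _ (Submodule.subset_span ⟨(u, s), rfl⟩)
  · rw [Submodule.span_le]
    rintro _ ⟨⟨u, s⟩, rfl⟩
    refine ⟨⟨(hz u s).1, fun e he => hvan u s e he⟩, fun v v' => ?_⟩
    dsimp only
    rw [hval]
    split_ifs
    · exact acoeff_of_two_le hI v' s.1.2.1
    · exact map_zero _

/-- Stability of the relations forces the weights of `D` to be constant on components. Subtracting
the corresponding combination of the `t` leaves a cocycle supported on `Z`, which is a combination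
of the `z`. -/
theorem linearCocycles_eq_span [Finite (o ⟶ w)] (hQ : IsToupie o w) (hne : o ≠ w)
    (hI : IsAdmissible I)
    {t : (branchGraph I o w).ConnectedComponent → hochschildCocycle₁ k (PathAlgebra k V ⧸ I)}
    (ht : ∀ c, t c ∈ normalCocycles I ∧ ∀ e : QArrow V, (t c).1 (arrowClass I e) =
      firstWeight (componentIndicator c) e • arrowClass I e)
    {z : (o ⟶ w) → IrreducibleLongBranch I o w → hochschildCocycle₁ k (PathAlgebra k V ⧸ I)}
    (hz : ∀ u s, z u s ∈ normalCocycles I ∧ ∀ e : QArrow V, (z u s).1 (arrowClass I e) =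
      zCochain I u s.1.1 e) :
    linearCocycles I o w hI = Submodule.span k (Set.range t ∪
      Set.range fun us : (o ⟶ w) × IrreducibleLongBranch I o w => z us.1 us.2) := by
  classical
  have := Fintype.ofFinite (branchGraph I o w).ConnectedComponent
  have htL : ∀ c, t c ∈ linearCocycles I o w hI := by
    intro c
    refine ⟨⟨(ht c).1, fun e he => ?_⟩, fun u v => ?_⟩
    · rw [(ht c).2]
      rcases he with he | ⟨p, hp⟩
      · rw [firstWeight_eq_zero_of_ne _ he, zero_smul]
      · rw [firstWeight_eq hQ _ hp, componentIndicator_of_not c fun h => h.2 p.2, zero_smul]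
    · have : (t c).1 (pathClass I u.toPath) = 0 := by
        refine ((ht c).2 ⟨o, w, u⟩).trans ?_
        rw [firstWeight_eq hQ _ (isFirstArrow_toPath u),
          componentIndicator_of_not c fun h => absurd h.1 (by simp), zero_smul]
      rw [this, map_zero]
  rw [Submodule.span_union, ← arrowCocycles_eq_span hne hI hz]
  apply le_antisymm
  · intro D hD
    have hcomp : ∀ c : (branchGraph I o w).ConnectedComponent, ∃ x : k, ∀ p : LongBranch I o w,
        (branchGraph I o w).connectedComponentMk p = c →
          pathWeight (diagCoeff hI D) p.1 = x := by
      intro c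
      obtain ⟨q, rfl⟩ := c.exists_rep
      refine ⟨pathWeight (diagCoeff hI D) q.1, fun p hp => ?_⟩
      obtain ⟨W⟩ := SimpleGraph.ConnectedComponent.exact hp
      -- Along each edge of the walk the weight is unchanged, by `IsDiagStable.eq_of_row`.
      induction W with
      | nil => rfl
      | cons h _ ih =>
        obtain ⟨-, ρ, hρ, h1, h2⟩ := h
        rw [← ih (SimpleGraph.ConnectedComponent.sound ⟨‹_›⟩)]
        exact (isDiagStable_of_mem_normalCocycles hQ hI hD.1.1).eq_of_row hρ h1 h2
    choose x hx using hcomp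
    have hmem : D - ∑ c, x c • t c ∈ arrowCocycles I o w hI := by
      have hL : D - ∑ c, x c • t c ∈ linearCocycles I o w hI := Submodule.sub_mem _ hD
        (Submodule.sum_mem _ fun c _ => Submodule.smul_mem _ _ (htL c))
      refine ⟨⟨hL.1.1, fun e he => ?_⟩, hL.2⟩
      by_cases hS : e.1 ≠ o ∨ ∃ p : MonomialBranch I o w, IsFirstArrow e p.1
      · exact hL.1.2 e hS
      · push Not at hS
        obtain ⟨a, b, e⟩ := e
        obtain rfl : a = o := hS.1
        obtain ⟨p, hp⟩ := exists_branch_of_source hQ e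
        have hpI : ofPath p ∉ I := fun h => hS.2 ⟨p, h⟩ hp
        -- A branch that is an arrow would be equal to its first arrow `e`, which is not in `Z` by
        -- `he`.
        have hlen : 2 ≤ p.length := by
          rcases p.eq_toPath_or_two_le_length hne with ⟨u, rfl⟩ | h
          · obtain ⟨v, f, q, h1, h2⟩ := hp
            cases h1
            cases q with
            | nil => exact absurd ⟨rfl, rfl⟩ he
            | cons q g =>
              have := congrArg Path.length h2
              simp at this
          · exact h
        have hdz : ∀ e : QArrow V, e.1 ≠ a → diagCoeff hI D e = 0 := fun e he => by
          rw [diagCoeff]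
          exact (congrArg (acoeff hI e.2.2) (hD.1.2 e (Or.inl he))).trans (map_zero _)
        rw [sub_apply, sum_apply, sub_eq_zero, Finset.sum_eq_single
          ((branchGraph I a w).connectedComponentMk ⟨p, hlen, hpI⟩)]
        · rw [smul_apply, (ht _).2, firstWeight_eq hQ _ hp,
            componentIndicator_long _ ⟨p, hlen, hpI⟩, if_pos rfl, one_smul, ← hx _ _ rfl,
            pathWeight_branch hQ hdz hp]
          exact apply_arrow hQ hI hD.1.1 e he
        · intro c _ hc
          rw [smul_apply, (ht _).2, firstWeight_eq hQ _ hp,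
            componentIndicator_long _ ⟨p, hlen, hpI⟩, if_neg hc.symm, zero_smul, smul_zero]
        · simp
    rw [← sub_add_cancel D (∑ c, x c • t c)]
    exact Submodule.add_mem _ (Submodule.mem_sup_right hmem) (Submodule.mem_sup_left
      (Submodule.sum_mem _ fun c _ => Submodule.smul_mem _ _ (Submodule.subset_span ⟨c, rfl⟩)))
  · refine sup_le ?_ (arrowCocycles_le hQ hI)
    rw [Submodule.span_le]
    rintro _ ⟨c, rfl⟩
    exact htL c

end PathAlgebra

/-! ### Comparison with inner derivations, and decomposition of cocycles with scalar matrix. -/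

namespace PathAlgebra

open LieAlgebra

variable {k V : Type*} [Field k] [Quiver V] [Fintype V] [DecidableEq V]
  {I : Ideal (PathAlgebra k V)} [I.IsTwoSided] {o w : V}

theorem diagCoeff_sub (hI : IsAdmissible I) (D E : hochschildCocycle₁ k (PathAlgebra k V ⧸ I))
    (e : QArrow V) : diagCoeff hI (D - E) e = diagCoeff hI D e - diagCoeff hI E e := by
  rw [diagCoeff, sub_apply, map_sub]; rfl

theorem acoeff_innerCocycle (hI : IsAdmissible I) (a : PathAlgebra k V ⧸ I) {i j : V}
    (e f : i ⟶ j) :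
    acoeff hI f ((innerCocycle a : hochschildCocycle₁ k (PathAlgebra k V ⧸ I)).1
      (pathClass I e.toPath)) =
      (vcoeff hI i a - vcoeff hI j a) * acoeff hI f (pathClass I e.toPath) := by
  rw [innerCocycle_apply, map_sub, acoeff_mul_toPath, acoeff_toPath_mul, sub_mul]

/-- The sum telescopes, so the weight depends only on the end points. -/
theorem pathWeight_diagCoeff_innerCocycle (hI : IsAdmissible I) (a : PathAlgebra k V ⧸ I) {i j : V}
    (p : Path i j) :
    pathWeight (diagCoeff hI (innerCocycle a : hochschildCocycle₁ k (PathAlgebra k V ⧸ I))) p =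
      vcoeff hI i a - vcoeff hI j a := by
  induction p with
  | nil => rw [pathWeight_nil, sub_self]
  | cons p e ih =>
    rw [pathWeight_cons, ih, diagCoeff, acoeff_innerCocycle, acoeff_self]
    ring

/-- No nonzero cocycle spanned by those of the form `y` is cohomologous to one spanned by those of
the form `t` and `z`. -/
theorem eq_zero_of_monomialCocycles (hQ : IsToupie o w) (hI : IsAdmissible I) (u : o ⟶ w)
    {D E : hochschildCocycle₁ k (PathAlgebra k V ⧸ I)} (hD : D ∈ monomialCocycles I o w)
    (hE : E ∈ linearCocycles I o w hI) {a : PathAlgebra k V ⧸ I} (h : D - E = innerCocycle a) :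
    D = 0 := by
  have hne := hQ.source_ne_sink u
  have hdiag : ∀ {F : hochschildCocycle₁ k (PathAlgebra k V ⧸ I)} {e : QArrow V},
      F.1 (arrowClass I e) = 0 → diagCoeff hI F e = 0 := fun {F e} he => by
    rw [diagCoeff]
    exact (congrArg (acoeff hI e.2.2) he).trans (map_zero _)
  have hD0 : ∀ e : QArrow V, e.1 ≠ o → diagCoeff hI D e = 0 := fun e he =>
    hdiag (hD.2 e fun ⟨q, hq⟩ => he (IsFirstArrow.source_eq hq))
  have hE0 : ∀ e : QArrow V, e.1 ≠ o → diagCoeff hI E e = 0 := fun e he =>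
    hdiag (hE.1.2 e (Or.inl he))
  -- Neither `D` nor `E` has a diagonal coefficient at `u`, so the weight of the inner derivation
  -- from `o` to `w` is zero. Along a monomial branch that weight is the coefficient of `D` at the
  -- first arrow.
  have hu : vcoeff hI o a - vcoeff hI w a = 0 := by
    rw [← pathWeight_diagCoeff_innerCocycle hI a u.toPath, ← h, pathWeight_toPath, diagCoeff_sub,
      diagCoeff, diagCoeff]
    have h1 := monomialCocycles_le hQ hI hD u u
    have h2 := hE.2 u u
    exact (congrArg₂ (· - ·) h1 h2).trans (sub_zero 0)
  refine cocycle_ext_of_arrows hD.1 (Submodule.zero_mem _) fun e => ?_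
  by_cases he : ∃ p : MonomialBranch I o w, IsFirstArrow e p.1
  · obtain ⟨p, hp⟩ := he
    have h1 := pathWeight_diagCoeff_innerCocycle hI a p.1
    rw [hu, ← h, pathWeight_branch hQ (fun e he => by
      rw [diagCoeff_sub, hD0 e he, hE0 e he, sub_zero]) hp, diagCoeff_sub,
      hdiag (hE.1.2 e (Or.inr ⟨p, hp⟩)), sub_zero] at h1
    have h2 := apply_arrow hQ hI hD.1 e.2.2
      (ne_of_isFirstArrow hQ (two_le_length_of_mem hI p.2) hp)
    exact h2.trans ((congrArg (· • arrowClass I e) h1).trans (zero_smul _ _))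
  · exact hD.2 e he

/-- A cocycle acting by a scalar on the arrows from the source to the sink is, up to an inner
derivation, a sum of cocycles of the form `t`, `z` and `y`. -/
theorem exists_decomposition [Finite (Path o w)] [LinearOrder (Path o w)] (hQ : IsToupie o w)
    (hne : o ≠ w) (hI : IsAdmissible I) {D : hochschildCocycle₁ k (PathAlgebra k V ⧸ I)}
    (hD : D ∈ normalCocycles I) (l : k)
    (hl : ∀ u v : o ⟶ w, acoeff hI v (D.1 (pathClass I u.toPath)) =
      l * acoeff hI v (pathClass I u.toPath)) :
    ∃ a, ∃ E ∈ linearCocycles I o w hI, ∃ F ∈ monomialCocycles I o w,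
      D = innerCocycle a + (E + F) := by
  classical
  let path : ∀ v, Path v w := fun v => (hQ.exists_path_sink v).some
  -- A potential whose drop across each arrow not leaving `o` is the eigenvalue of `D` there. As `c
  -- w = 0`, the value `l` at `o` matches the scalar action on `Z`.
  let c : V → k := fun v => if v = o then l else pathWeight (diagCoeff hI D) (path v)
  let a : PathAlgebra k V ⧸ I := ∑ v, c v • idem I v
  have ha1 : ∀ {i j : V} (p : Path i j), a * pathClass I p = c i • pathClass I p := by
    intro i j p
    rw [Finset.sum_mul, Finset.sum_eq_single i]
    · rw [smul_mul_assoc, idem_mul_pathClass]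
    · intro v _ hv
      rw [smul_mul_assoc, idem, pathClass_mul_of_ne I hv.symm, smul_zero]
    · simp
  have ha2 : ∀ {i j : V} (p : Path i j), pathClass I p * a = c j • pathClass I p := by
    intro i j p
    rw [Finset.mul_sum, Finset.sum_eq_single j]
    · rw [mul_smul_comm, pathClass_mul_idem]
    · intro v _ hv
      rw [mul_smul_comm, idem, pathClass_mul_of_ne I hv, smul_zero]
    · simp
  have hinner : ∀ {i j : V} (p : Path i j),
      (innerCocycle a : hochschildCocycle₁ k (PathAlgebra k V ⧸ I)).1 (pathClass I p) =
        (c i - c j) • pathClass I p := fun p => by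
    rw [innerCocycle_apply, ha1, ha2, sub_smul]
  have hN : (innerCocycle a : hochschildCocycle₁ k (PathAlgebra k V ⧸ I)) ∈ normalCocycles I :=
    fun v => by rw [hinner, sub_self, zero_smul]
  set D' := D - innerCocycle a with hD'
  have hD'N : D' ∈ normalCocycles I := Submodule.sub_mem _ hD hN
  have hD'0 : ∀ e : QArrow V, e.1 ≠ o → D'.1 (arrowClass I e) = 0 := by
    rintro ⟨i, j, e⟩ hi
    have hj := hQ.target_ne_source e
    have hi : i ≠ o := hi
    rw [hD', sub_apply, hinner]
    have h1 := apply_arrow hQ hI hD e fun h => hi h.1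
    have := hQ.subsingleton_path_of_ne_source (x := w) hi
    have h2 : pathWeight (diagCoeff hI D) (path i) =
        diagCoeff hI D ⟨i, j, e⟩ + pathWeight (diagCoeff hI D) (path j) := by
      rw [Subsingleton.elim (path i) (e.toPath.comp (path j)), pathWeight_comp, pathWeight_toPath]
    have h3 : c i - c j = diagCoeff hI D ⟨i, j, e⟩ := by
      simp only [c, if_neg hi, if_neg hj, h2, add_sub_cancel_right]
    rw [h3]
    exact sub_eq_zero.2 h1
  have hcw : c w = 0 := by
    simp only [c, if_neg hne.symm, hQ.path_eq_nil (path w), pathWeight_nil]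
  have hD'n : D' ∈ nonlinearCocycles o w hI := by
    intro u v
    rw [hD', sub_apply, map_sub, hl, hinner, map_smul, hcw, sub_zero, smul_eq_mul]
    simp [c]
  -- The cocycle `F` with these weights removes the action of `D'` on first arrows of monomial
  -- branches; `d` is zero on long branches, so no relation obstructs it.
  let d : Path o w → k := fun p => if ofPath p ∈ I then pathWeight (diagCoeff hI D') p else 0
  obtain ⟨F, hFN, hF⟩ := exists_branchCocycle hQ hne hI d fun r _ =>
    ⟨0, Submodule.zero_mem _, fun i => by
      exact ((congrArg (· * r i) (if_neg i.2.2)).trans (zero_mul _)).symm⟩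
  have hFm : F ∈ monomialCocycles I o w := by
    refine ⟨hFN, fun e he => ?_⟩
    rw [hF, firstWeight_eq_zero, zero_smul]
    exact fun p hp => if_neg fun hpI => he ⟨⟨p, hpI⟩, hp⟩
  have hdz : ∀ e : QArrow V, e.1 ≠ o → diagCoeff hI D' e = 0 := fun e he => by
    rw [diagCoeff]
    exact (congrArg (acoeff hI e.2.2) (hD'0 e he)).trans (map_zero _)
  refine ⟨a, D' - F, ⟨⟨Submodule.sub_mem _ hD'N hFN, fun e he => ?_⟩,
    Submodule.sub_mem _ hD'n (monomialCocycles_le hQ hI hFm)⟩, F, hFm, ?_⟩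
  · rcases he with he | ⟨p, hp⟩
    · rw [sub_apply, hD'0 e he, hFm.2 e fun ⟨q, hq⟩ => he (IsFirstArrow.source_eq hq), sub_zero]
    · rw [sub_apply, hF, firstWeight_eq hQ _ hp, show d p.1 = _ from if_pos p.2,
        pathWeight_branch hQ hdz hp, sub_eq_zero]
      exact apply_arrow hQ hI hD'N e.2.2
        (ne_of_isFirstArrow hQ (two_le_length_of_mem hI p.2) hp)
  · rw [hD']
    abel

/-! #### The projection to the special linear Lie algebra -/

section SpecialLinear

variable {n : Type*} [Fintype n] [DecidableEq n]

/-- The matrix of the action of a cocycle on the arrows from the source to the sink. -/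
noncomputable def arrowMatrix (hI : IsAdmissible I) (ε : n ≃ (o ⟶ w)) :
    hochschildCocycle₁ k (PathAlgebra k V ⧸ I) →ₗ[k] Matrix n n k where
  toFun D := Matrix.of fun i j => acoeff hI (ε i) (D.1 (pathClass I (ε j).toPath))
  map_add' D E := by
    ext i j
    exact map_add (acoeff hI (ε i)) _ _
  map_smul' c D := by
    ext i j
    exact map_smul (acoeff hI (ε i)) _ _

omit [Fintype n] [DecidableEq n] in
theorem arrowMatrix_apply (hI : IsAdmissible I) (ε : n ≃ (o ⟶ w))
    (D : hochschildCocycle₁ k (PathAlgebra k V ⧸ I)) (i j : n) :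
    arrowMatrix hI ε D i j = acoeff hI (ε i) (D.1 (pathClass I (ε j).toPath)) := rfl

theorem acoeff_toPath (hI : IsAdmissible I) [DecidableEq (o ⟶ w)] (u v : o ⟶ w) :
    acoeff hI u (pathClass I v.toPath) = if u = v then 1 else 0 := by
  split_ifs with h
  · rw [h, acoeff_self]
  · refine acoeff_of_ne hI fun h' => h ?_
    exact Hom.toPath_injective (eq_of_heq (by simpa using h'.symm))

-- Inner derivations need not have zero matrix, only a scalar one, which is why the traceless part
-- is taken before passing to cohomology.
omit [Fintype n] in
theorem arrowMatrix_innerCocycle (hI : IsAdmissible I) (ε : n ≃ (o ⟶ w))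
    (a : PathAlgebra k V ⧸ I) :
    arrowMatrix hI ε (innerCocycle a) =
      (vcoeff hI o a - vcoeff hI w a) • (1 : Matrix n n k) := by
  classical
  ext i j
  rw [arrowMatrix_apply, acoeff_innerCocycle, acoeff_toPath, Matrix.smul_apply, Matrix.one_apply,
    smul_eq_mul]
  simp only [ε.injective.eq_iff]

omit [DecidableEq n] in
theorem arrowMatrix_lie (hQ : IsToupie o w) (hne : o ≠ w) (hI : IsAdmissible I)
    (ε : n ≃ (o ⟶ w)) {D E : hochschildCocycle₁ k (PathAlgebra k V ⧸ I)}
    (hD : D ∈ normalCocycles I) (hE : E ∈ normalCocycles I) :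
    arrowMatrix hI ε ⁅D, E⁆ =
      arrowMatrix hI ε D * arrowMatrix hI ε E - arrowMatrix hI ε E * arrowMatrix hI ε D := by
  have := Fintype.ofEquiv n ε
  have key : ∀ {D E : hochschildCocycle₁ k (PathAlgebra k V ⧸ I)}, D ∈ normalCocycles I →
      E ∈ normalCocycles I → ∀ i j, acoeff hI (ε i) (D.1 (E.1 (pathClass I (ε j).toPath))) =
        (arrowMatrix hI ε D * arrowMatrix hI ε E) i j := by
    intro D E hD hE i j
    rw [acoeff_apply hQ hne hI hD _ (apply_mem_corner hE (pathClass_mem_corner I _)),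
      Matrix.mul_apply, ← ε.sum_comp]
    exact Finset.sum_congr rfl fun x _ => mul_comm _ _
  ext i j
  rw [arrowMatrix_apply, lie_apply, map_sub, key hD hE, key hE hD, Matrix.sub_apply]

variable [CharZero k] [Nonempty n]

/-- The traceless part of a matrix. -/
noncomputable def traceless : Matrix n n k →ₗ[k] SpecialLinear.sl n k :=
  LinearMap.codRestrict (SpecialLinear.sl n k).toSubmodule
    (LinearMap.id - ((Fintype.card n : k)⁻¹ • Matrix.traceLinearMap n k k).smulRight 1) fun X => by
      change Matrix.trace _ = 0
      have hn : (Fintype.card n : k) ≠ 0 := Nat.cast_ne_zero.2 Fintype.card_ne_zero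
      simp [mul_right_comm _ X.trace, hn]

theorem traceless_apply (X : Matrix n n k) :
    (traceless X).1 = X - ((Fintype.card n : k)⁻¹ * X.trace) • 1 := rfl

theorem traceless_smul_one (c : k) : traceless (c • (1 : Matrix n n k)) = 0 := by
  apply Subtype.ext
  rw [traceless_apply]
  simp [mul_comm c]

theorem traceless_commutator (X Y : Matrix n n k) :
    traceless (X * Y - Y * X) = ⁅traceless X, traceless Y⁆ := by
  apply Subtype.ext
  rw [SpecialLinear.sl_bracket, traceless_apply, traceless_apply, traceless_apply,
    Matrix.trace_sub, Matrix.trace_mul_comm, sub_self, mul_zero, zero_smul, sub_zero]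
  simp only [sub_mul, mul_sub, smul_mul_assoc, mul_smul_comm, one_mul, mul_one]
  simp only [smul_sub, smul_smul]
  rw [mul_comm ((Fintype.card n : k)⁻¹ * X.trace)]
  abel

theorem traceless_eq_zero {X : Matrix n n k} (h : traceless X = 0) : ∃ c : k, X = c • 1 :=
  ⟨_, sub_eq_zero.1 ((traceless_apply X).symm.trans (congrArg Subtype.val h))⟩

theorem traceless_of_mem {X : Matrix n n k} (h : X.trace = 0) : (traceless X).1 = X := by
  rw [traceless_apply, h, mul_zero, zero_smul, sub_zero]

/-- A Lie algebra homomorphism out of a quotient. -/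
def _root_.LieIdeal.quotientLift {G S : Type*} [LieRing G] [LieAlgebra k G] [LieRing S]
    [LieAlgebra k S] (J : LieIdeal k G) (f : G →ₗ[k] S) (hJ : ∀ x ∈ J, f x = 0)
    (hf : ∀ x y, f ⁅x, y⁆ = ⁅f x, f y⁆) : G ⧸ J →ₗ⁅k⁆ S :=
  { Submodule.liftQ J.toSubmodule f hJ with
    map_lie' := by
      rintro ⟨x⟩ ⟨y⟩
      exact hf x y }

theorem traceless_arrowMatrix_innerCocycle (hI : IsAdmissible I) (ε : n ≃ (o ⟶ w))
    (a : PathAlgebra k V ⧸ I) : traceless (arrowMatrix hI ε (innerCocycle a)) = 0 := by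
  rw [arrowMatrix_innerCocycle, traceless_smul_one]

/-- Matrices are multiplicative for normalised cocycles. In general both cocycles are normalised by
inner derivations, and all the correction terms are coboundaries, invisible to the traceless part.
-/
theorem traceless_arrowMatrix_lie (hQ : IsToupie o w) (hne : o ≠ w) (hI : IsAdmissible I)
    (ε : n ≃ (o ⟶ w)) (D E : hochschildCocycle₁ k (PathAlgebra k V ⧸ I)) :
    traceless (arrowMatrix hI ε ⁅D, E⁆) =
      ⁅traceless (arrowMatrix hI ε D), traceless (arrowMatrix hI ε E)⁆ := by
  obtain ⟨a, ha⟩ := exists_sub_inner_mem_normalCocycles D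
  obtain ⟨b, hb⟩ := exists_sub_inner_mem_normalCocycles E
  have h0 : ∀ F ∈ hochschildCoboundary₁ k (PathAlgebra k V ⧸ I),
      traceless (arrowMatrix hI ε F) = 0 := by
    intro F hF
    obtain ⟨c, rfl⟩ := mem_hochschildCoboundary₁.1 hF
    exact traceless_arrowMatrix_innerCocycle hI ε c
  have h1 : ⁅D, E⁆ = ⁅D - innerCocycle a, E - innerCocycle b⁆ +
      (⁅D, innerCocycle b⁆ + ⁅(innerCocycle a : hochschildCocycle₁ k (PathAlgebra k V ⧸ I)),
        E - innerCocycle b⁆) := by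
    simp only [sub_lie, lie_sub]
    abel
  have h2 : ∀ (F : hochschildCocycle₁ k (PathAlgebra k V ⧸ I)) c,
      traceless (arrowMatrix hI ε (F - innerCocycle c)) = traceless (arrowMatrix hI ε F) := by
    intro F c
    rw [map_sub, map_sub, traceless_arrowMatrix_innerCocycle, sub_zero]
  rw [h1, map_add, map_add, h0 (_ + _), add_zero, arrowMatrix_lie hQ hne hI ε ha hb,
    traceless_commutator, h2, h2]
  exact add_mem (lie_mem_right k _ _ _ _ (innerCocycle_mem b))
    (lie_mem_left k _ _ _ _ (innerCocycle_mem a))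

/-- The Lie algebra homomorphism from the first Hochschild cohomology to the special linear Lie
algebra. -/
noncomputable def toSL (hQ : IsToupie o w) (hne : o ≠ w) (hI : IsAdmissible I)
    (ε : n ≃ (o ⟶ w)) : HH₁ k (PathAlgebra k V ⧸ I) →ₗ⁅k⁆ SpecialLinear.sl n k :=
  LieIdeal.quotientLift _ (traceless ∘ₗ arrowMatrix hI ε)
    (fun F hF => by
      obtain ⟨c, rfl⟩ := mem_hochschildCoboundary₁.1 hF
      exact traceless_arrowMatrix_innerCocycle hI ε c)
    (traceless_arrowMatrix_lie hQ hne hI ε)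

theorem toSL_mk (hQ : IsToupie o w) (hne : o ≠ w) (hI : IsAdmissible I) (ε : n ≃ (o ⟶ w))
    (D : hochschildCocycle₁ k (PathAlgebra k V ⧸ I)) :
    toSL hQ hne hI ε (LieSubmodule.Quotient.mk D) = traceless (arrowMatrix hI ε D) := rfl

theorem toSL_surjective (hQ : IsToupie o w) (hne : o ≠ w) (hI : IsAdmissible I)
    (ε : n ≃ (o ⟶ w)) : Function.Surjective (toSL hQ hne hI ε) := by
  classical
  intro X
  -- Values on the arrows of `Z` are unconstrained, so the columns of `X` can be prescribed.
  obtain ⟨D, -, hD, -⟩ := exists_arrowCocycle hQ hI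
    (fun u => ∑ i, X.1 i (ε.symm u) • pathClass I (ε i).toPath) fun u =>
      Submodule.sum_mem _ fun i _ => Submodule.smul_mem _ _ (pathClass_mem_corner I _)
  refine ⟨LieSubmodule.Quotient.mk D, ?_⟩
  have hM : arrowMatrix hI ε D = X.1 := by
    ext i j
    rw [arrowMatrix_apply, hD, map_sum, Finset.sum_eq_single i]
    · rw [map_smul, acoeff_self, smul_eq_mul, mul_one, Equiv.symm_apply_apply]
    · intro l _ hl
      rw [map_smul, acoeff_toPath, if_neg fun h => hl (ε.injective h).symm, smul_zero]
    · simp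
  rw [toSL_mk, hM]
  exact Subtype.ext (traceless_of_mem X.2)

end SpecialLinear

end PathAlgebra

/-! ### The radical of the first Hochschild cohomology. -/

namespace PathAlgebra

open LieAlgebra

variable {k V : Type*} [Field k] [Quiver V] [Fintype V] [DecidableEq V]
  {I : Ideal (PathAlgebra k V)} [I.IsTwoSided] {o w : V}

variable (I) in
/-- The class of a cocycle, as a linear map. -/
noncomputable def cocycleClass :
    hochschildCocycle₁ k (PathAlgebra k V ⧸ I) →ₗ[k] HH₁ k (PathAlgebra k V ⧸ I) where
  toFun D := LieSubmodule.Quotient.mk D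
  map_add' _ _ := rfl
  map_smul' _ _ := rfl

theorem cocycleClass_lie (D E : hochschildCocycle₁ k (PathAlgebra k V ⧸ I)) :
    cocycleClass I ⁅D, E⁆ = ⁅cocycleClass I D, cocycleClass I E⁆ :=
  LieSubmodule.Quotient.mk_bracket _ D E

theorem cocycleClass_eq_zero {D : hochschildCocycle₁ k (PathAlgebra k V ⧸ I)} :
    cocycleClass I D = 0 ↔ ∃ a, D = innerCocycle a :=
  LieSubmodule.Quotient.mk_eq_zero'.trans mem_hochschildCoboundary₁

theorem exists_normal_representative (x : HH₁ k (PathAlgebra k V ⧸ I)) :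
    ∃ D ∈ normalCocycles I, cocycleClass I D = x := by
  obtain ⟨D, rfl⟩ := LieSubmodule.Quotient.surjective_mk' _ x
  obtain ⟨a, ha⟩ := exists_sub_inner_mem_normalCocycles D
  refine ⟨_, ha, ?_⟩
  rw [map_sub, cocycleClass_eq_zero.2 ⟨a, rfl⟩, sub_zero]
  rfl

/-- The Lie ideal of classes of cocycles in a subspace stable under the normalized cocycles. -/
noncomputable def classIdeal (S : Submodule k (hochschildCocycle₁ k (PathAlgebra k V ⧸ I)))
    (h : ∀ D ∈ normalCocycles I, ∀ E ∈ S, ⁅D, E⁆ ∈ S) : LieIdeal k (HH₁ k (PathAlgebra k V ⧸ I)) :=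
  { S.map (cocycleClass I) with
    lie_mem := by
      rintro x _ ⟨E, hE, rfl⟩
      obtain ⟨D, hD, rfl⟩ := exists_normal_representative x
      exact ⟨⁅D, E⁆, h D hD E hE, cocycleClass_lie D E⟩ }

section Ideals

variable [Finite (o ⟶ w)] [Finite (Path o w)]

variable (o w) in
/-- The Lie ideal of the classes of the form `z`. -/
noncomputable def arrowIdeal (hQ : IsToupie o w) (hne : o ≠ w) (hI : IsAdmissible I) :
    LieIdeal k (HH₁ k (PathAlgebra k V ⧸ I)) :=
  classIdeal (arrowCocycles I o w hI) fun _ hD _ hE =>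
    lie_mem_arrowCocycles hQ hne hI hD hE.1.1 hE.2

variable (o w) in
/-- The Lie ideal of the classes of the form `t` and `z`. -/
noncomputable def linearIdeal (hQ : IsToupie o w) (hne : o ≠ w) (hI : IsAdmissible I) :
    LieIdeal k (HH₁ k (PathAlgebra k V ⧸ I)) :=
  classIdeal (linearCocycles I o w hI) fun _ hD _ hE =>
    arrowCocycles_le hQ hI (lie_mem_arrowCocycles hQ hne hI hD hE.1.1 hE.2)

variable (o w) in
/-- The Lie ideal of the classes of the form `y`. -/
noncomputable def monomialIdeal (hQ : IsToupie o w) (hne : o ≠ w) (hI : IsAdmissible I) :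
    LieIdeal k (HH₁ k (PathAlgebra k V ⧸ I)) :=
  classIdeal (monomialCocycles I o w) fun _ hD _ hE => by
    rw [lie_monomialCocycles hQ hne hI hD hE]
    exact Submodule.zero_mem _

theorem isSolvable_linearIdeal (hQ : IsToupie o w) (hne : o ≠ w) (hI : IsAdmissible I) :
    IsSolvable (linearIdeal o w hQ hne hI) := by
  refine isSolvable_of_lie_mem (k := k) (Z := arrowIdeal o w hQ hne hI) ?_ ?_
  · rintro _ ⟨D, hD, rfl⟩ _ ⟨E, hE, rfl⟩
    exact ⟨⁅D, E⁆, lie_mem_arrowCocycles hQ hne hI hD.1.1 hE.1.1 hE.2, cocycleClass_lie D E⟩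
  · rintro _ ⟨D, hD, rfl⟩ _ ⟨E, hE, rfl⟩
    rw [← cocycleClass_lie, lie_arrowCocycles hQ hne hI hD hE, map_zero]

omit [Finite (o ⟶ w)] in
theorem isSolvable_monomialIdeal (hQ : IsToupie o w) (hne : o ≠ w) (hI : IsAdmissible I) :
    IsSolvable (monomialIdeal o w hQ hne hI) := by
  have h : ∀ x ∈ monomialIdeal o w hQ hne hI, ∀ y ∈ monomialIdeal o w hQ hne hI, ⁅x, y⁆ = 0 := by
    rintro _ ⟨D, hD, rfl⟩ _ ⟨E, hE, rfl⟩
    rw [← cocycleClass_lie, lie_monomialCocycles hQ hne hI hD.1 hE, map_zero]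
  refine isSolvable_of_lie_mem (k := k) (Z := ⊥) (fun x hx y hy => ?_) fun x hx y _ => ?_
  · rw [h x hx y hy]
    exact zero_mem _
  · rw [(LieSubmodule.mem_bot x).1 hx, zero_lie]

theorem linearIdeal_inf_monomialIdeal (hQ : IsToupie o w) (u : o ⟶ w) (hI : IsAdmissible I) :
    linearIdeal o w hQ (hQ.source_ne_sink u) hI ⊓ monomialIdeal o w hQ (hQ.source_ne_sink u) hI =
      ⊥ := by
  rw [eq_bot_iff]
  rintro _ ⟨⟨E, hE, rfl⟩, ⟨D, hD, hDE⟩⟩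
  have h0 : cocycleClass I (D - E) = 0 := by rw [map_sub, hDE, sub_self]
  obtain ⟨a, ha⟩ := cocycleClass_eq_zero.1 h0
  have := eq_zero_of_monomialCocycles hQ hI u hD hE ha
  rw [LieSubmodule.mem_bot, ← hDE, this, map_zero]

variable {n : Type*} [Fintype n] [DecidableEq n] [CharZero k] [Nonempty n]

/-- A class in the kernel has a normalised representative with scalar matrix, which is what
`exists_decomposition` requires. -/
theorem ker_toSL_le [LinearOrder (Path o w)] (hQ : IsToupie o w) (hne : o ≠ w)
    (hI : IsAdmissible I) (ε : n ≃ (o ⟶ w)) :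
    (toSL hQ hne hI ε).ker ≤ linearIdeal o w hQ hne hI ⊔ monomialIdeal o w hQ hne hI := by
  classical
  intro x hx
  obtain ⟨D, hD, rfl⟩ := exists_normal_representative x
  obtain ⟨c, hc⟩ := traceless_eq_zero ((LieHom.mem_ker).1 hx : traceless (arrowMatrix hI ε D) = 0)
  obtain ⟨a, E, hE, F, hF, h⟩ := exists_decomposition hQ hne hI hD c fun u v => by
    have := congrFun (congrFun hc (ε.symm v)) (ε.symm u)
    rw [arrowMatrix_apply, ε.apply_symm_apply, ε.apply_symm_apply] at this
    rw [this, acoeff_toPath, Matrix.smul_apply, Matrix.one_apply, smul_eq_mul]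
    simp only [ε.symm.injective.eq_iff]
  rw [h, map_add, cocycleClass_eq_zero.2 ⟨a, rfl⟩, zero_add, map_add]
  exact add_mem (LieSubmodule.mem_sup_left ⟨E, hE, rfl⟩) (LieSubmodule.mem_sup_right ⟨F, hF, rfl⟩)

theorem radical_eq_sup [LinearOrder (Path o w)] (hQ : IsToupie o w) (hne : o ≠ w)
    (hI : IsAdmissible I) (ε : n ≃ (o ⟶ w)) :
    radical k (HH₁ k (PathAlgebra k V ⧸ I)) =
      linearIdeal o w hQ hne hI ⊔ monomialIdeal o w hQ hne hI := by
  have := hasTrivialRadical_sl (k := k) n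
  apply le_antisymm
  · exact (radical_le_ker _ (toSL_surjective hQ hne hI ε)).trans (ker_toSL_le hQ hne hI ε)
  · exact sup_le (le_sSup (isSolvable_linearIdeal hQ hne hI))
      (le_sSup (isSolvable_monomialIdeal hQ hne hI))

theorem radical_eq_ker [LinearOrder (Path o w)] (hQ : IsToupie o w) (hne : o ≠ w)
    (hI : IsAdmissible I) (ε : n ≃ (o ⟶ w)) :
    radical k (HH₁ k (PathAlgebra k V ⧸ I)) = (toSL hQ hne hI ε).ker := by
  have := hasTrivialRadical_sl (k := k) n
  refine le_antisymm (radical_le_ker _ (toSL_surjective hQ hne hI ε)) ?_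
  rw [radical_eq_sup hQ hne hI ε]
  exact ker_toSL_le hQ hne hI ε

theorem nonempty_quotient_radical_equiv [LinearOrder (Path o w)] (hQ : IsToupie o w) (hne : o ≠ w)
    (hI : IsAdmissible I) (ε : n ≃ (o ⟶ w)) :
    Nonempty ((HH₁ k (PathAlgebra k V ⧸ I) ⧸ radical k (HH₁ k (PathAlgebra k V ⧸ I))) ≃ₗ⁅k⁆
      SpecialLinear.sl n k) := by
  rw [radical_eq_ker hQ hne hI ε]
  have hr : (toSL hQ hne hI ε).range = ⊤ :=
    (LieHom.range_eq_top _).2 (toSL_surjective hQ hne hI ε)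
  exact ⟨((toSL hQ hne hI ε).quotKerEquivRange.trans (LieEquiv.ofEq _ _
    (by rw [hr]))).trans
    LieSubalgebra.topEquiv⟩

end Ideals

theorem isClassOf_cocycleClass {D : hochschildCocycle₁ k (PathAlgebra k V ⧸ I)}
    (hD : D ∈ normalCocycles I) {φ : QArrow V → PathAlgebra k V ⧸ I}
    (h : ∀ e : QArrow V, D.1 (arrowClass I e) = φ e) : IsClassOf I φ (cocycleClass I D) :=
  ⟨D, hD, h, rfl⟩

end PathAlgebra

end HochschildCohomology

open PathAlgebra in
theorem mainTheorem9 {V : Type*} [Quiver V] [Fintype V] [DecidableEq V]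
    [∀ x y : V, Finite (x ⟶ y)] (o w : V) (hQ : IsToupie o w)
    [LinearOrder (Quiver.Path o w)]
    (I : Ideal (PathAlgebra ℂ V)) [I.IsTwoSided] (hI : IsAdmissible I)
    (ha : Nonempty (o ⟶ w)) :
    ∃ (y : MonomialBranch I o w → HH₁ ℂ (PathAlgebra ℂ V ⧸ I))
      (t : (branchGraph I o w).ConnectedComponent → HH₁ ℂ (PathAlgebra ℂ V ⧸ I))
      (z : (o ⟶ w) → IrreducibleLongBranch I o w → HH₁ ℂ (PathAlgebra ℂ V ⧸ I))
      (L C : LieIdeal ℂ (HH₁ ℂ (PathAlgebra ℂ V ⧸ I))),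
      (∀ p, IsClassOf I (yCochain I p.1) (y p)) ∧
      (∀ c, IsClassOf I (tCochain I c) (t c)) ∧
      (∀ u s, IsClassOf I (zCochain I u s.1.1) (z u s)) ∧
      L.toSubmodule = Submodule.span ℂ (Set.range t ∪ Set.range (fun us : (o ⟶ w) ×
        IrreducibleLongBranch I o w => z us.1 us.2)) ∧
      C.toSubmodule = Submodule.span ℂ (Set.range y) ∧
      LieAlgebra.radical ℂ (HH₁ ℂ (PathAlgebra ℂ V ⧸ I)) = L ⊔ C ∧
      L ⊓ C = ⊥ ∧
      Nonempty ((HH₁ ℂ (PathAlgebra ℂ V ⧸ I) ⧸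
          LieAlgebra.radical ℂ (HH₁ ℂ (PathAlgebra ℂ V ⧸ I))) ≃ₗ⁅ℂ⁆
        LieAlgebra.SpecialLinear.sl (Fin (Nat.card (o ⟶ w))) ℂ) := by
  obtain ⟨u⟩ := ha
  have hne := hQ.source_ne_sink u
  have hfin := hQ.finite_branches hne
  let ε := (Finite.equivFin (o ⟶ w)).symm
  have : Nonempty (Fin (Nat.card (o ⟶ w))) := ⟨ε.symm u⟩
  choose y hy using exists_yCocycle hQ hne hI
  choose t ht using exists_tCocycle hQ hne hI
  choose z hz using fun (u : o ⟶ w) (s : IrreducibleLongBranch I o w) =>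
    exists_zCocycle hQ hI u s.1.1
  refine ⟨fun p => cocycleClass I (y p), fun c => cocycleClass I (t c),
    fun u s => cocycleClass I (z u s), linearIdeal o w hQ hne hI, monomialIdeal o w hQ hne hI,
    fun p => isClassOf_cocycleClass (hy p).1 fun e => ?_,
    fun c => isClassOf_cocycleClass (ht c).1 fun e => ?_,
    fun u s => isClassOf_cocycleClass (hz u s).1 (hz u s).2, ?_, ?_,
    radical_eq_sup hQ hne hI ε, linearIdeal_inf_monomialIdeal hQ u hI,
    nonempty_quotient_radical_equiv hQ hne hI ε⟩
  · rw [(hy p).2, yCochain_eq hQ]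
  · rw [(ht c).2, tCochain_eq hQ]
  -- The ideal is by construction the image of `linearCocycles`, so the spanning set of cocycles is
  -- pushed forward.
  · refine (congrArg (Submodule.map (cocycleClass I))
      (linearCocycles_eq_span hQ hne hI ht hz)).trans ?_
    rw [Submodule.map_span, Set.image_union, ← Set.range_comp, ← Set.range_comp]
    rfl
  · refine (congrArg (Submodule.map (cocycleClass I)) (monomialCocycles_eq_span hQ hI hy)).trans ?_
    rw [Submodule.map_span, ← Set.range_comp]
    rfl
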